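/- **Setting.** $N$ users share $M\le N$ subchannels; time is slotted, $s>0$ is fixed and $e^{-s}$ is the discount factor per slot. The subchannel capacity of user $n$ is a Markov chain on a finite set $\mathcal C$ of channel states with positive data rates and with transition matrix $\mathbf C_n$; the chains of different users are independent. Videos have $L\ge 1$ layers, and a sub-segment of layer $l$ of user $n$ has size $q_{n,l}>0$. A slot has length $\tau_{slot}=\min_{n,l}q_{n,l}/\max\mathcal C$ (the shortest possible download), and a segment of user $n$ plays for $U_n$ slots. The state of user $n$ is $(c,\mathbf b,u)\in\mathcal S_n=\mathcal C\times\{0,\dots,b_{max,n}\}^L\times\{0,\dots,U_n-1\}$: channel state, number of buffered sub-segments per layer, number of slots for which the current segment has been playing. In a slot, if there is no base layer ($b_1=0$), playback stalls, nothing changes and the reward is $r_{pen,n}$. Otherwise the reward is $\exp(-\phi_n(R_p/R_{max})^{-\theta_n}+\phi_n)$, where $R_{max}=\sum_l q_{n,l}$ and $R_p$ is the sum of the $q_{n,l}$ over the layers $l$ such that the layers $1,\dots,l$ are all in the buffer, and $u$ increases by one; when $u$ reaches $U_n$ it is reset to $0$ and each nonempty layer loses one sub-segment. Let $R^k_{x}$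 be the reward in the slot that comes $k$ slots after state $x$ if only playback takes place. At its decision times user $n$ is assigned an action $a\in\{0,1,\dots,L\}$. The passive action $a=0$ takes $\tau=1$ slot. The active action $a=l\ge1$ downloads one sub-segment of layer $l$ and takes the least number $\tau$ of slots with $\sum_{k=1}^{\tau}c_k\ge q_{n,l}/\tau_{slot}$, where $c_1,c_2,\dots$ are the rates from the decision on. During the action $\tau$ slots are played; then, if $a=l\ge1$, $b_l$ becomes $\min(b_l+1,b_{max,n})$, and the next decision is made. Let $f^a_c(t,j)$ be the probability that action $a$, started in channel state $c$, takes $t$ slots and that the channel state in the slot after these is $j$; let $\mathbf P^a(t)$ be the binary matrix of the resulting map of $(\mathbf b,u)$. The discounted transition matrix $\mathbf H^a_n=(h^a_{xx'})$ has blocks $\mathbf V^a_{i,j}=\sum_{k\ge1}e^{-sk}f^a_i(k,j)\mathbf P^a(k)$. The initial states are independent with laws $(\alpha_{x})_{x\in\mathcal S_n}$. A policy $u$ chooses, in every slot and possibly at random, actions for the users that are at a decision, given the whole history of all users. It is Markov if there are fixed laws $\varphi_n(\cdot\mid x)$ such that, whenever user $n$ makes a decision in a state $x$, the conditional law of its action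 given the history is $\varphi_n(\cdot\mid x)$. Let $\sigma^m_n$, $x^m_n$, $a^m_n$, $\tau^m_n$ be slot, state, action and duration of the $m$-th decision of user $n$, and let $I^a_{x}(k)=1$ if user $n$ is assigned $a$ in state $x$ by a decision in slot $k$, and $0$ otherwise. Put $y^a_{x}(u)=\mathbb E_u\big[\sum_{k\ge0}I^a_{x}(k)e^{-sk}\big]$. Fix $\varepsilon\in\{0,1\}$, the convention for the last slot of an action: an action of duration $\tau$ is charged for the slots of offset $0\le k\le\tau-1+\varepsilon$ after its start ($\varepsilon=1$: $k=0,\dots,\tau$; $\varepsilon=0$: exactly the $\tau$ slots during which it runs). The multi-user semi-Markov decision process (MUSMDP) is the problem $$\max_u\ J(u),\qquad J(u)=\mathbb E_u\Big[\sum_{n}\sum_{m\ge0}e^{-s\sigma^m_n}\sum_{k=0}^{\tau^m_n-1+\varepsilon}e^{-sk}R^k_{x^m_n}\Big],$$ over the policies $u$ whose expected discounted number of occupied subchannels $$D(u)=\mathbb E_u\Big[\sum_{k\ge0}e^{-sk}\,\#\{(n,m):a^m_n\ne0,\ \sigma^m_n\le k\le\sigma^m_n+\tau^m_n-1+\varepsilon\}\Big]$$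 equals $M/(1-e^{-s})$. **Theorem.** All these series and expectations converge, and the MUSMDP can be formulated as the linear program $$\max_{\mathbf y}\ \sum_{n}\sum_{x\in\mathcal S_n}\sum_{a=0}^L\bar r^a_{x}\,y^a_{x}\quad\text{subject to}\quad\mathbf y_n\in\mathcal P_n\ (1\le n\le N),\qquad\sum_{n}\sum_{a=1}^L\sum_{x\in\mathcal S_n}y^a_{x}\,\bar\tau^a_{x}=\frac{M}{1-e^{-s}},$$ where, for $x=(c,\mathbf b,u)$, $$\bar r^a_{x}=\sum_{t\ge0}\sum_{j\in\mathcal C}\sum_{k=0}^{t-1+\varepsilon}e^{-sk}R^k_{x}f^a_{c}(t,j),\qquad\bar\tau^a_{x}=\sum_{t\ge0}\sum_{j\in\mathcal C}\sum_{k=0}^{t-1+\varepsilon}e^{-sk}f^a_{c}(t,j),$$ $$\mathcal P_n=\Big\{\mathbf y_n\ge0:\ \sum_{a=0}^Ly^a_{j}=\alpha_{j}+\sum_{i\in\mathcal S_n}\sum_{a=0}^Lh^a_{ij}\,y^a_{i}\ \text{ for all }j\in\mathcal S_n\Big\}.$$ Precisely: (i) for every policy $u$, $\mathbf y_n(u)\in\mathcal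 P_n$ for all $n$, $J(u)=\sum_{n,x,a}\bar r^a_{x}y^a_{x}(u)$ and $D(u)=\sum_{n}\sum_{a\ge1}\sum_{x}y^a_{x}(u)\bar\tau^a_{x}$; (ii) the feasible set of the linear program is exactly the set of the $\mathbf y(u)$ for the policies $u$ admissible in the MUSMDP, and also exactly the set of the $\mathbf y(u)$ for the admissible Markov policies $u$; (iii) both maxima are attained, and they are equal. -/

import Mathlib

open MeasureTheory ProbabilityTheory

noncomputable section

namespace MUSMDP

/-- Playback status of a user: the number `b l ∈ {0, …, bmax}` of buffered sub-segments of every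
layer `l`, and the number `u ∈ {0, …, U - 1}` of slots for which the current segment has been
playing. -/
abbrev Play (L bmax U : ℕ) : Type := (Fin L → Fin (bmax + 1)) × Fin U

/-- The state `(c, b, u)` of a user: channel state, buffer, playback offset. -/
abbrev State (K L bmax U : ℕ) : Type := Fin K × Play L bmax U

/-- The data of one user (`K` channel states, `L` layers). -/
structure User (K L : ℕ) where
  /-- the rows of the channel transition matrix -/
  channel : Fin K → PMF (Fin K)
  /-- the buffer limit -/
  bmax : ℕ
  /-- the duration of a segment, in slots -/
  segSlots : ℕ
  /-- the size of a sub-segment of each layer -/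
  size : Fin L → ℝ
  size_pos : ∀ l, 0 < size l
  /-- the two parameters of the quality model -/
  φ : ℝ
  θ : ℝ
  /-- the reward of a slot in which playback stalls -/
  rpen : ℝ
  /-- the distribution of the initial state -/
  init : PMF (State K L bmax segSlots)

/-- The state space of a user. -/
abbrev User.S {K L : ℕ} (v : User K L) : Type := State K L v.bmax v.segSlots

/-- A network of `N` users; `rate c` is the data rate of a subchannel in channel state `c`. -/
structure Network (N K L : ℕ) where
  rate : Fin K → ℝ
  rate_pos : ∀ c, 0 < rate c
  user : Fin N → User K L

/-- The actions: `0` is passive, `l.succ` downloads one sub-segment of layer `l`. -/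
abbrev Action (L : ℕ) : Type := Fin (L + 1)

section Playback

variable {K L : ℕ} [NeZero L] (v : User K L)

/-- Playback during one slot. Without a base layer playback stalls. When the last slot of a segment
has been played, the segment leaves the buffer: each nonempty layer loses one sub-segment. -/
def playSlot (z : Play L v.bmax v.segSlots) : Play L v.bmax v.segSlots :=
  if z.1 0 = 0 then z
  else if h : (z.2 : ℕ) + 1 < v.segSlots then (z.1, ⟨z.2 + 1, h⟩)
  else (fun l => ⟨(z.1 l : ℕ) - 1, by have := (z.1 l).isLt; omega⟩,
    ⟨0, by have := z.2.isLt; omega⟩)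

/-- Delivery of one sub-segment of layer `l`; it is lost if that layer's buffer is full. -/
def deliver (l : Fin L) (z : Play L v.bmax v.segSlots) : Play L v.bmax v.segSlots :=
  (Function.update z.1 l ⟨min ((z.1 l : ℕ) + 1) v.bmax, by omega⟩, z.2)

/-- Playback status at the end of an action `a` of `t` slots: `t` slots are played, and then the
requested sub-segment, if there is one, is delivered. -/
def nextPlay (a : Action L) (t : ℕ) (z : Play L v.bmax v.segSlots) :
    Play L v.bmax v.segSlots :=
  Fin.cases ((playSlot v)^[t] z) (fun l => deliver v l ((playSlot v)^[t] z)) a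

/-- The (binary) policy matrix `P ^ a (t)`. -/
def policyMatrix (a : Action L) (t : ℕ) :
    Matrix (Play L v.bmax v.segSlots) (Play L v.bmax v.segSlots) ℝ :=
  Matrix.of fun z z' => if nextPlay v a t z = z' then 1 else 0

/-- The rate that is being played back: layer `l` is played if it and all layers below it are in
the buffer. (All segments have equal length, so rates are measured by sub-segment sizes.) -/
def playedRate (z : Play L v.bmax v.segSlots) : ℝ :=
  ∑ l : Fin L, if ∀ i ≤ l, z.1 i ≠ 0 then v.size l else 0

/-- The reward of a slot that starts with playback status `z`. -/
def slotReward (z : Play L v.bmax v.segSlots) : ℝ :=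
  if z.1 0 = 0 then v.rpen
  else Real.exp (-v.φ * (playedRate v z / ∑ l, v.size l) ^ (-v.θ) + v.φ)

/-- `R ^ k_x`: the reward in the slot that comes `k` slots after a decision in state `x`. -/
def reward (x : v.S) (k : ℕ) : ℝ := slotReward v ((playSlot v)^[k] x.2)

end Playback

variable {N K L : ℕ}

/-- The slot duration: the duration of the shortest possible download. -/
def tauSlot (net : Network N K L) : ℝ :=
  (⨅ p : Fin N × Fin L, (net.user p.1).size p.2) / ⨆ c, net.rate c

/-- The number of slots that action `a` of user `n` takes if `c 0, c 1, …` are the channel states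
in the slots from its start on: one slot for the passive action, and for the download of layer `l`
the least `t` such that the rates of the first `t` slots sum up to at least `size l / tauSlot`. -/
def duration (net : Network N K L) (n : Fin N) (a : Action L) (c : ℕ → Fin K) : ℕ :=
  Fin.cases 1
    (fun l => sInf {t : ℕ | (net.user n).size l / tauSlot net ≤
      ∑ i ∈ Finset.range t, net.rate (c i)}) a

/-- `f ^ a_c (t, j)`: the probability, for the channel Markov chain of user `n` started in `c`, that
action `a` takes `t` slots and that the channel state in the slot after these is `j`
(the sum of the probabilities of all such channel trajectories). -/
def durProb (net : Network N K L) (n : Fin N) (a : Action L) (c : Fin K) (t : ℕ) (j : Fin K) : ℝ :=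
  ∑ w : Fin (t + 1) → Fin K,
    if w 0 = c ∧ w (Fin.last t) = j ∧
        duration net n a (fun i => w ⟨min i t, by omega⟩) = t then
      ∏ i : Fin t, ((net.user n).channel (w i.castSucc) (w i.succ)).toReal
    else 0

section Dynamics

/-- What happens in the network: the initial states of all users at index `0`; at index `k + 1` the
actions requested for all users in slot `k`, and the channel states in slot `k + 1`. -/
def Slot (net : Network N K L) : ℕ → Type
  | 0 => ∀ n, (net.user n).S
  | _ + 1 => (Fin N → Action L) × (Fin N → Fin K)

instance instMeasurableSpaceSlot (net : Network N K L) : ∀ k, MeasurableSpace (Slot net k)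
  | 0 => inferInstanceAs (MeasurableSpace (∀ n, (net.user n).S))
  | _ + 1 => inferInstanceAs (MeasurableSpace ((Fin N → Action L) × (Fin N → Fin K)))

instance instFiniteSlot (net : Network N K L) : ∀ k, Finite (Slot net k)
  | 0 => inferInstanceAs (Finite (∀ n, (net.user n).S))
  | _ + 1 => inferInstanceAs (Finite ((Fin N → Action L) × (Fin N → Fin K)))

instance instMeasurableSingletonClassSlot (net : Network N K L) :
    ∀ k, MeasurableSingletonClass (Slot net k)
  | 0 => inferInstanceAs (MeasurableSingletonClass (∀ n, (net.user n).S))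
  | _ + 1 => inferInstanceAs (MeasurableSingletonClass ((Fin N → Action L) × (Fin N → Fin K)))

/-- Full trajectories. -/
abbrev Traj (net : Network N K L) : Type := ∀ k, Slot net k

/-- Everything that is known at the start of slot `k`: initial states, channel states up to slot
`k`, actions in the slots before `k`. -/
abbrev History (net : Network N K L) (k : ℕ) : Type := ∀ i : Finset.Iic k, Slot net i

/-- A joint scheduling and quality adaptation policy, history dependent and randomized: in every
slot it draws an action vector. (Actions drawn for users that are still executing an earlier action
have no effect, see `epoch`.) -/
abbrev Policy (net : Network N K L) : Type :=
  ∀ k, History net k → PMF (Fin N → Action L)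

/-- The channel states in slot `k`. -/
def chanOf (net : Network N K L) : ∀ k, Slot net k → Fin N → Fin K
  | 0 => fun x n => (x n).1
  | _ + 1 => fun x n => x.2 n

/-- One slot: the policy draws the actions, and the channels of the users move independently of
each other according to their transition matrices. -/
def stepMeasure (net : Network N K L) (u : Policy net) (k : ℕ) (h : History net k) :
    Measure (Slot net (k + 1)) :=
  (u k h).toMeasure.prod (Measure.pi fun n =>
    ((net.user n).channel (chanOf net k (h ⟨k, Finset.mem_Iic.2 le_rfl⟩) n)).toMeasure)

instance instIsProbabilityMeasureStep (net : Network N K L) (u : Policy net) (k : ℕ)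
    (h : History net k) : IsProbabilityMeasure (stepMeasure net u k h) :=
  inferInstanceAs (IsProbabilityMeasure ((u k h).toMeasure.prod (Measure.pi fun n =>
    ((net.user n).channel (chanOf net k (h ⟨k, Finset.mem_Iic.2 le_rfl⟩) n)).toMeasure)))

/-- `stepMeasure` as a Markov kernel. -/
def stepKernel (net : Network N K L) (u : Policy net) (k : ℕ) :
    Kernel (History net k) (Slot net (k + 1)) where
  toFun := stepMeasure net u k
  measurable' := measurable_of_finite _

instance instIsMarkovKernelStep (net : Network N K L) (u : Policy net) (k : ℕ) :
    IsMarkovKernel (stepKernel net u k) :=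
  ⟨fun h => instIsProbabilityMeasureStep net u k h⟩

/-- The joint law of the (independent) initial states. -/
def initMeasure (net : Network N K L) : Measure (Slot net 0) :=
  Measure.pi fun n => (net.user n).init.toMeasure

/-- The law of the trajectory under policy `u`. -/
def law (net : Network N K L) (u : Policy net) : Measure (Traj net) :=
  Kernel.trajMeasure (initMeasure net) (stepKernel net u)

variable {net : Network N K L}

/-- The channel state of user `n` in slot `k`. -/
def chanAt (ω : Traj net) (n : Fin N) (k : ℕ) : Fin K := chanOf net k (ω k) n

/-- The action drawn for user `n` in slot `k`. -/
def actionAt (ω : Traj net) (n : Fin N) (k : ℕ) : Action L :=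
  (show (Fin N → Action L) × (Fin N → Fin K) from ω (k + 1)).1 n

variable [NeZero L]

/-- The slot `σ ^ m` of the `m`-th decision of user `n`, and the state of the user at that time. The
next decision is made once the chosen action is fully executed. -/
def epoch (ω : Traj net) (n : Fin N) : ℕ → ℕ × (net.user n).S
  | 0 => (0, (show ∀ n, (net.user n).S from ω 0) n)
  | m + 1 =>
    let σ := (epoch ω n m).1
    let a := actionAt ω n σ
    let t := duration net n a (fun i => chanAt ω n (σ + i))
    (σ + t, (chanAt ω n (σ + t), nextPlay (net.user n) a t (epoch ω n m).2.2))

/-- The slot of the `m`-th decision. -/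
def decSlot (ω : Traj net) (n : Fin N) (m : ℕ) : ℕ := (epoch ω n m).1

/-- The state at the `m`-th decision. -/
def decState (ω : Traj net) (n : Fin N) (m : ℕ) : (net.user n).S := (epoch ω n m).2

/-- The action chosen at the `m`-th decision. -/
def decAction (ω : Traj net) (n : Fin N) (m : ℕ) : Action L := actionAt ω n (decSlot ω n m)

/-- The duration of the action chosen at the `m`-th decision. -/
def decDur (ω : Traj net) (n : Fin N) (m : ℕ) : ℕ :=
  duration net n (decAction ω n m) (fun i => chanAt ω n (decSlot ω n m + i))

/-- The discounted reward of user `n` for its `m`-th action. An action that takes `τ` slots collects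
the rewards of offsets `k < τ + ε`: these are `0, …, τ` for `ε = 1` and `0, …, τ - 1` for
`ε = 0`. -/
def stageReward (s : ℝ) (ε : ℕ) (ω : Traj net) (n : Fin N) (m : ℕ) : ℝ :=
  Real.exp (-s) ^ decSlot ω n m * ∑ k ∈ Finset.range (decDur ω n m + ε),
    Real.exp (-s) ^ k * reward (net.user n) (decState ω n m) k

/-- The total discounted reward. -/
def totalReward (s : ℝ) (ε : ℕ) (ω : Traj net) : ℝ := ∑ n, ∑' m, stageReward s ε ω n m

/-- The number of subchannels charged in slot `k`: every download occupies one subchannel in the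
slots of offsets `< τ + ε` after its start. For `ε = 0` this is the number of active users. -/
def occupied (ε : ℕ) (ω : Traj net) (k : ℕ) : ℕ :=
  ∑ n, Set.ncard {m : ℕ | decAction ω n m ≠ 0 ∧ decSlot ω n m ≤ k ∧
    k < decSlot ω n m + decDur ω n m + ε}

/-- The discounted number of occupied subchannels. -/
def totalOccupied (s : ℝ) (ε : ℕ) (ω : Traj net) : ℝ :=
  ∑' k, Real.exp (-s) ^ k * (occupied ε ω k : ℝ)

open Classical in
/-- `I ^ a_x (k)`: in slot `k` user `n` is in state `x` and is assigned action `a`. -/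
def indicator (ω : Traj net) (n : Fin N) (x : (net.user n).S) (a : Action L) (k : ℕ) : ℝ :=
  if ∃ m, decSlot ω n m = k ∧ decState ω n m = x ∧ decAction ω n m = a then 1 else 0

/-- The discounted number of times that user `n` is assigned `a` in state `x`. -/
def visits (s : ℝ) (ω : Traj net) (n : Fin N) (x : (net.user n).S) (a : Action L) : ℝ :=
  ∑' k, Real.exp (-s) ^ k * indicator ω n x a k

/-- The objective of the decision process: the expected total discounted reward. -/
def value (s : ℝ) (ε : ℕ) (u : Policy net) : ℝ := ∫ ω, totalReward s ε ω ∂(law net u)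

/-- The expected discounted number of occupied subchannels. -/
def usage (s : ℝ) (ε : ℕ) (u : Policy net) : ℝ := ∫ ω, totalOccupied s ε ω ∂(law net u)

/-- Candidate variables of the linear program: `y n x a`. -/
abbrev Var (net : Network N K L) : Type := ∀ n, (net.user n).S → Action L → ℝ

/-- The discounted occupation measure of a policy. -/
def occupation (s : ℝ) (u : Policy net) : Var net :=
  fun n x a => ∫ ω, visits s ω n x a ∂(law net u)

/-- The policies that use, in expectation and discounted, `M` subchannels per slot. -/
def Admissible (s : ℝ) (ε M : ℕ) : Set (Policy net) :=
  {u | usage s ε u = M / (1 - Real.exp (-s))}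

/-- Stationary randomized Markov policies: whenever user `n` makes a decision, in state `x` say, the
conditional law of its action given the whole history is `φ n x`. -/
def IsMarkov (u : Policy net) : Prop :=
  ∃ φ : ∀ n, (net.user n).S → PMF (Action L), ∀ (k : ℕ) (ω : Traj net) (n : Fin N) (m : ℕ),
    decSlot ω n m = k →
      (u k (Preorder.frestrictLe k ω)).map (fun a => a n) = φ n (decState ω n m)

/-- All series and expectations above converge. -/
def WellPosed (net : Network N K L) (s : ℝ) (ε : ℕ) : Prop :=
  (∀ (ω : Traj net) (n : Fin N), Summable (stageReward s ε ω n)) ∧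
  (∀ ω : Traj net, Summable fun k => Real.exp (-s) ^ k * (occupied ε ω k : ℝ)) ∧
  (∀ (ω : Traj net) (n : Fin N) (x : (net.user n).S) (a : Action L),
    Summable fun k => Real.exp (-s) ^ k * indicator ω n x a k) ∧
  ∀ u : Policy net, Integrable (totalReward s ε) (law net u) ∧
    Integrable (totalOccupied s ε) (law net u) ∧
    ∀ (n : Fin N) (x : (net.user n).S) (a : Action L),
      Integrable (fun ω => visits s ω n x a) (law net u)

end Dynamics

section LinearProgram

variable [NeZero L] (net : Network N K L)

/-- The expected discounted reward of action `a` in state `x`. -/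
def rbar (s : ℝ) (ε : ℕ) (n : Fin N) (x : (net.user n).S) (a : Action L) : ℝ :=
  ∑' t : ℕ, ∑ c : Fin K, ∑ k ∈ Finset.range (t + ε),
    Real.exp (-s) ^ k * reward (net.user n) x k * durProb net n a x.1 t c

/-- The expected discounted duration of action `a` in state `x`. -/
def taubar (s : ℝ) (ε : ℕ) (n : Fin N) (x : (net.user n).S) (a : Action L) : ℝ :=
  ∑' t : ℕ, ∑ c : Fin K, ∑ k ∈ Finset.range (t + ε),
    Real.exp (-s) ^ k * durProb net n a x.1 t c

/-- The block `V ^ a_{i, j}` of the discounted transition matrix. -/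
def blockV (s : ℝ) (n : Fin N) (a : Action L) (i j : Fin K) :
    Matrix (Play L (net.user n).bmax (net.user n).segSlots)
      (Play L (net.user n).bmax (net.user n).segSlots) ℝ :=
  Matrix.of fun z z' => ∑' k : ℕ,
    Real.exp (-s) ^ k * durProb net n a i k j * policyMatrix (net.user n) a k z z'

/-- The discounted transition matrix `H ^ a` of user `n`. -/
def matH (s : ℝ) (n : Fin N) (a : Action L) : Matrix (net.user n).S (net.user n).S ℝ :=
  Matrix.of fun x x' => blockV net s n a x.1 x'.1 x.2 x'.2

/-- The polytope of user `n`. -/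
def polytope (s : ℝ) (n : Fin N) : Set ((net.user n).S → Action L → ℝ) :=
  {y | (∀ x a, 0 ≤ y x a) ∧
    ∀ j, ∑ a, y j a = ((net.user n).init j).toReal + ∑ i, ∑ a, matH net s n a i j * y i a}

/-- The objective of the linear program. -/
def lpObjective (s : ℝ) (ε : ℕ) (y : Var net) : ℝ :=
  ∑ n, ∑ x, ∑ a, rbar net s ε n x a * y n x a

/-- The left-hand side of the resource constraint; the sum is over the active actions. -/
def lpUsage (s : ℝ) (ε : ℕ) (y : Var net) : ℝ :=
  ∑ n, ∑ l : Fin L, ∑ x, y n x l.succ * taubar net s ε n x l.succ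

/-- The feasible set of the linear program. -/
def lpFeasible (s : ℝ) (ε M : ℕ) : Set (Var net) :=
  {y | (∀ n, y n ∈ polytope net s n) ∧ lpUsage net s ε y = M / (1 - Real.exp (-s))}

end LinearProgram

end MUSMDP

end

namespace MUSMDP

/-! ### Durations of actions as bounded stopping times of the channel. -/

section Duration

variable {N K L : ℕ} (net : Network N K L)

/-! Reward, charged slots and visits are all discounted sums over decisions of a function of state,
action, duration and channel state at the end of the action. A decision and its action are known at
the slot where they occur, and from there the user's channel is still a Markov chain, whatever the
policy does and whatever the other users do. So the conditional law of duration and final channel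
state is `durProb`, and the expectation of such a sum is linear in the occupation measure
(`integral_tsum_decTerm`). This yields the formulas for objective and resource use. It also yields
the flow balance: every decision after the first is made in the state in which the previous action
ended.

Conversely, normalizing the rows of a point of the product of the polytopes gives action laws, and a
Markov policy draws from them. Its occupation measure satisfies the same balance equations with the
same action laws. The transition matrix averaged over these laws has row sums at most `exp (-s)`, so
the difference of the two solutions vanishes (`polytope_unique`). Hence the linear program ranges
exactly over occupation measures, already over those of Markov policies.

The maximum exists by compactness. Summing the balance equations bounds every coordinate, and a
feasible point is a mixture of "never download" and "always download", the latter using at least `N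
≥ M` subchannels per slot. -/

lemma tauSlot_pos [NeZero L] (n : Fin N) (c : Fin K) : 0 < tauSlot net := by
  have : Nonempty (Fin N × Fin L) := ⟨(n, 0)⟩
  refine div_pos ?_ ((net.rate_pos c).trans_le (le_ciSup (Set.finite_range _).bddAbove c))
  obtain ⟨p, hp⟩ := exists_eq_ciInf_of_finite (f := fun p : Fin N × Fin L => (net.user p.1).size p.2)
  rw [← hp]
  exact (net.user p.1).size_pos p.2

lemma duration_zero (n : Fin N) (c : ℕ → Fin K) : duration net n 0 c = 1 := rfl

lemma duration_succ (n : Fin N) (l : Fin L) (c : ℕ → Fin K) :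
    duration net n l.succ c = sInf {t : ℕ | (net.user n).size l / tauSlot net ≤
      ∑ i ∈ Finset.range t, net.rate (c i)} := rfl

/-- Every download is completed within a number of slots that does not depend on the channel. -/
lemma exists_download_bound (n : Fin N) (l : Fin L) : ∃ T : ℕ, ∀ c : ℕ → Fin K,
    (net.user n).size l / tauSlot net ≤ ∑ i ∈ Finset.range T, net.rate (c i) := by
  rcases isEmpty_or_nonempty (Fin K) with hK | hK
  · exact ⟨0, fun c => isEmptyElim (c 0)⟩
  -- The slowest channel state gives a bound valid for every channel trajectory.
  · obtain ⟨c₀, hc₀⟩ := Finite.exists_min net.rate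
    obtain ⟨T, hT⟩ := exists_nat_ge ((net.user n).size l / tauSlot net / net.rate c₀)
    refine ⟨T, fun c => ?_⟩
    rw [div_le_iff₀ (net.rate_pos c₀)] at hT
    calc _ ≤ (T : ℝ) * net.rate c₀ := hT
      _ = ∑ i ∈ Finset.range T, net.rate c₀ := by simp
      _ ≤ _ := Finset.sum_le_sum fun i _ => hc₀ _

/-- There are finitely many users and layers, so one bound serves all. It turns every series over
durations into a finite sum. -/
lemma exists_duration_le : ∃ T : ℕ, ∀ n a (c : ℕ → Fin K), duration net n a c ≤ T := by
  choose B hB using fun p : Fin N × Fin L => exists_download_bound net p.1 p.2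
  refine ⟨1 + ∑ p, B p, fun n a c => ?_⟩
  induction a using Fin.cases with
  | zero => rw [duration_zero]; omega
  | succ l =>
    have h₁ : duration net n l.succ c ≤ B (n, l) := Nat.sInf_le (hB (n, l) c)
    have h₂ : B (n, l) ≤ ∑ p, B p := Finset.single_le_sum (fun _ _ => Nat.zero_le _) (Finset.mem_univ _)
    omega

/-- An empty sum of rates cannot reach a positive size. Consequently decision slots strictly
increase and each action discounts by at least one factor `exp (-s)`. -/
lemma duration_pos [NeZero L] (n : Fin N) (a : Action L) (c : ℕ → Fin K) : 0 < duration net n a c := by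
  induction a using Fin.cases with
  | zero => rw [duration_zero]; omega
  | succ l =>
    obtain ⟨T, hT⟩ := exists_download_bound net n l
    have h := Nat.sInf_mem (s := {t : ℕ | (net.user n).size l / tauSlot net ≤
      ∑ i ∈ Finset.range t, net.rate (c i)}) ⟨T, hT c⟩
    rw [← duration_succ] at h
    by_contra h0
    obtain h0 : duration net n l.succ c = 0 := by omega
    rw [h0] at h
    have := div_pos ((net.user n).size_pos l) (tauSlot_pos net n (c 0))
    simp at h
    linarith

/-- The duration of an action is determined by the channel states while it runs. -/
lemma duration_congr (n : Fin N) (a : Action L) {c c' : ℕ → Fin K}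
    (h : ∀ i < duration net n a c, c i = c' i) : duration net n a c' = duration net n a c := by
  induction a using Fin.cases with
  | zero => rfl
  | succ l =>
    obtain ⟨T, hT⟩ := exists_download_bound net n l
    have hsum : ∀ t ≤ duration net n l.succ c, ∑ i ∈ Finset.range t, net.rate (c' i) =
        ∑ i ∈ Finset.range t, net.rate (c i) := fun t ht =>
      Finset.sum_congr rfl fun i hi => by rw [h i ((Finset.mem_range.1 hi).trans_le ht)]
    have hmem := Nat.sInf_mem (s := {t : ℕ | (net.user n).size l / tauSlot net ≤
      ∑ i ∈ Finset.range t, net.rate (c i)}) ⟨T, hT c⟩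
    rw [← duration_succ] at hmem
    refine le_antisymm (Nat.sInf_le ?_) ?_
    · rw [Set.mem_ofPred_eq, hsum _ le_rfl]; exact hmem
    -- If `c'` finished earlier, its sum up to then would agree with that of `c`, against the
    -- minimality of the duration for `c`.
    · by_contra hlt
      push Not at hlt
      have hmem' := Nat.sInf_mem (s := {t : ℕ | (net.user n).size l / tauSlot net ≤
        ∑ i ∈ Finset.range t, net.rate (c' i)}) ⟨T, hT c'⟩
      rw [← duration_succ, Set.mem_ofPred_eq, hsum _ hlt.le] at hmem'
      exact Nat.notMem_of_lt_sInf hlt hmem'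

/-- The stopping time property: whether the duration equals `t` is read off from the first `t`
channel states. -/
lemma duration_eq_iff_of_eq (n : Fin N) (a : Action L) {c c' : ℕ → Fin K} {t : ℕ}
    (h : ∀ i < t, c i = c' i) : duration net n a c = t ↔ duration net n a c' = t :=
  ⟨fun ht => (duration_congr net n a fun i hi => h i (ht ▸ hi)).trans ht,
    fun ht => (duration_congr net n a fun i hi => (h i (ht ▸ hi)).symm).trans ht⟩

end Duration

/-! ### Decision epochs and their dependence on the history. -/

section Epoch

variable {N K L : ℕ} {net : Network N K L}

lemma chanAt_congr {ω ω' : Traj net} {k : ℕ} (h : ω k = ω' k) (n : Fin N) :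
    chanAt ω n k = chanAt ω' n k := by rw [chanAt, chanAt, h]

lemma actionAt_congr {ω ω' : Traj net} {k : ℕ} (h : ω (k + 1) = ω' (k + 1)) (n : Fin N) :
    actionAt ω n k = actionAt ω' n k := by unfold actionAt; rw [h]

variable [NeZero L]

lemma decSlot_zero (ω : Traj net) (n : Fin N) : decSlot ω n 0 = 0 := rfl

lemma decSlot_succ (ω : Traj net) (n : Fin N) (m : ℕ) :
    decSlot ω n (m + 1) = decSlot ω n m + decDur ω n m := rfl

lemma decState_succ (ω : Traj net) (n : Fin N) (m : ℕ) :
    decState ω n (m + 1) = (chanAt ω n (decSlot ω n m + decDur ω n m),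
      nextPlay (net.user n) (decAction ω n m) (decDur ω n m) (decState ω n m).2) := rfl

lemma decState_fst (ω : Traj net) (n : Fin N) (m : ℕ) :
    (decState ω n m).1 = chanAt ω n (decSlot ω n m) := by
  cases m <;> rfl

lemma decDur_pos (ω : Traj net) (n : Fin N) (m : ℕ) : 0 < decDur ω n m := duration_pos ..

lemma decSlot_strictMono (ω : Traj net) (n : Fin N) : StrictMono (decSlot ω n) :=
  strictMono_nat_of_lt_succ fun m => by
    rw [decSlot_succ]; have := decDur_pos ω n m; omega

/-- Decisions up to slot `k` are determined by what is known at the start of slot `k`. -/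
lemma epoch_congr {ω ω' : Traj net} {k : ℕ} (h : ∀ i ≤ k, ω i = ω' i) (n : Fin N) (m : ℕ)
    (hm : decSlot ω n m ≤ k) : epoch ω' n m = epoch ω n m := by
  induction m with
  | zero => simp only [epoch]; rw [h 0 (Nat.zero_le _)]
  | succ m ih =>
    rw [decSlot_succ] at hm
    have hpos := decDur_pos ω n m
    have ih := ih (by omega)
    have ha : actionAt ω' n (decSlot ω n m) = actionAt ω n (decSlot ω n m) :=
      actionAt_congr (h _ (by omega)).symm n
    have hd : duration net n (actionAt ω n (decSlot ω n m))
        (fun i => chanAt ω' n (decSlot ω n m + i)) = decDur ω n m :=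
      duration_congr net n _ fun i hi => chanAt_congr (h _ (by
        change i < decDur ω n m at hi; omega)) n
    have hc : chanAt ω' n (decSlot ω n m + decDur ω n m) =
        chanAt ω n (decSlot ω n m + decDur ω n m) := chanAt_congr (h _ hm).symm n
    simp only [epoch, ih]
    change (decSlot ω n m + _, (chanAt ω' n (decSlot ω n m + _), _)) = _
    change (decSlot ω n m + duration net n (actionAt ω' n (decSlot ω n m))
        (fun i => chanAt ω' n (decSlot ω n m + i)),
      (chanAt ω' n (decSlot ω n m + duration net n (actionAt ω' n (decSlot ω n m))
        (fun i => chanAt ω' n (decSlot ω n m + i))),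
      nextPlay (net.user n) (actionAt ω' n (decSlot ω n m))
        (duration net n (actionAt ω' n (decSlot ω n m))
        (fun i => chanAt ω' n (decSlot ω n m + i))) (decState ω n m).2)) =
      (decSlot ω n m + decDur ω n m, (chanAt ω n (decSlot ω n m + decDur ω n m),
      nextPlay (net.user n) (decAction ω n m) (decDur ω n m) (decState ω n m).2))
    rw [ha, hd, hc]; rfl

/-- In slot `k`, user `n` makes a decision in state `x`. -/
def DecidesIn (ω : Traj net) (n : Fin N) (x : (net.user n).S) (k : ℕ) : Prop :=
  ∃ m, decSlot ω n m = k ∧ decState ω n m = x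

lemma decidesIn_congr {ω ω' : Traj net} {k : ℕ} (h : ∀ i ≤ k, ω i = ω' i) (n : Fin N)
    (x : (net.user n).S) : DecidesIn ω n x k ↔ DecidesIn ω' n x k := by
  constructor
  · rintro ⟨m, hm, hx⟩
    have := epoch_congr h n m hm.le
    exact ⟨m, by rw [decSlot, this]; exact hm, by rw [decState, this]; exact hx⟩
  · rintro ⟨m, hm, hx⟩
    have := epoch_congr (fun i hi => (h i hi).symm) n m hm.le
    exact ⟨m, by rw [decSlot, this]; exact hm, by rw [decState, this]; exact hx⟩

lemma DecidesIn.unique {ω : Traj net} {n : Fin N} {x y : (net.user n).S} {k : ℕ}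
    (hx : DecidesIn ω n x k) (hy : DecidesIn ω n y k) : x = y := by
  obtain ⟨m, hm, rfl⟩ := hx
  obtain ⟨m', hm', rfl⟩ := hy
  rw [(decSlot_strictMono ω n).injective (hm.trans hm'.symm)]

lemma DecidesIn.chanAt_eq {ω : Traj net} {n : Fin N} {x : (net.user n).S} {k : ℕ}
    (hx : DecidesIn ω n x k) : chanAt ω n k = x.1 := by
  obtain ⟨m, hm, rfl⟩ := hx
  rw [decState_fst, hm]

lemma exists_dec_iff (ω : Traj net) (n : Fin N) (x : (net.user n).S) (a : Action L) (k : ℕ) :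
    (∃ m, decSlot ω n m = k ∧ decState ω n m = x ∧ decAction ω n m = a) ↔
      DecidesIn ω n x k ∧ actionAt ω n k = a := by
  constructor
  · rintro ⟨m, rfl, hx, ha⟩
    exact ⟨⟨m, rfl, hx⟩, ha⟩
  · rintro ⟨⟨m, rfl, hx⟩, ha⟩
    exact ⟨m, rfl, hx, ha⟩

-- The first factor depends on the history up to slot `k`, the second only on the action drawn then.
-- This is the form needed for conditioning on the history.
open Classical in
lemma indicator_eq (ω : Traj net) (n : Fin N) (x : (net.user n).S) (a : Action L) (k : ℕ) :
    indicator ω n x a k =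
      (if DecidesIn ω n x k then 1 else 0) * (if actionAt ω n k = a then 1 else 0) := by
  rw [indicator, exists_dec_iff]
  by_cases h₁ : DecidesIn ω n x k <;> by_cases h₂ : actionAt ω n k = a <;> simp [h₁, h₂]

end Epoch

/-! ### Conditional laws of actions and channel transitions. -/

section Law

variable {N K L : ℕ} {net : Network N K L}

instance instIsProbabilityMeasureInit : IsProbabilityMeasure (initMeasure net) :=
  inferInstanceAs (IsProbabilityMeasure (Measure.pi fun n => (net.user n).init.toMeasure))

instance instIsProbabilityMeasureLaw (u : Policy net) : IsProbabilityMeasure (law net u) := by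
  unfold law; infer_instance

lemma law_map_zero (u : Policy net) : (law net u).map (fun ω => ω 0) = initMeasure net := by
  let f : History net 0 → Slot net 0 := fun h => h ⟨0, by simp⟩
  have hf : Measurable f := measurable_of_finite f
  change (law net u).map (f ∘ Preorder.frestrictLe 0) = _
  rw [← Measure.map_map hf (by fun_prop), law, Kernel.trajMeasure,
    Measure.map_comp _ _ (by fun_prop), Kernel.traj_map_frestrictLe, Kernel.partialTraj_self,
    Measure.id_comp]
  exact (Measure.map_map hf (MeasurableEquiv.measurable _)).trans Measure.map_id

/-- The conditional law of what happens in slot `k`, given the history. -/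
lemma integral_law_succ (u : Policy net) (k : ℕ) (G : History net k → Slot net (k + 1) → ℝ) :
    ∫ ω, G (Preorder.frestrictLe k ω) (ω (k + 1)) ∂law net u =
      ∫ h, ∫ y, G h y ∂stepMeasure net u k h ∂(law net u).map (Preorder.frestrictLe k) := by
  have hG : Measurable (Function.uncurry G) := measurable_of_finite _
  have : IsProbabilityMeasure ((law net u).map (Preorder.frestrictLe (π := Slot net) k)) :=
    Measure.isProbabilityMeasure_map (by fun_prop)
  have h := Kernel.map_frestrictLe_trajMeasure_compProd_eq_map_trajMeasure
    (μ₀ := initMeasure net) (κ := stepKernel net u) (a := k)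
  calc _ = ∫ p, Function.uncurry G p
        ∂(law net u).map (fun ω => (Preorder.frestrictLe k ω, ω (k + 1))) := by
        rw [integral_map (by fun_prop) hG.aestronglyMeasurable]; rfl
    _ = ∫ p, Function.uncurry G p
        ∂((law net u).map (Preorder.frestrictLe k) ⊗ₘ stepKernel net u k) := by
        rw [law, h]
    _ = _ := Measure.integral_compProd Integrable.of_finite

/-- `F` depends only on what is known once the actions of slot `k` have been drawn. -/
def KnownAt (k : ℕ) (F : Traj net → ℝ) : Prop :=
  ∀ ω ω' : Traj net, (∀ i ≤ k, ω i = ω' i) → (∀ n, actionAt ω n k = actionAt ω' n k) → F ω = F ω'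

lemma KnownAt.mul {k : ℕ} {F G : Traj net → ℝ} (hF : KnownAt k F) (hG : KnownAt k G) :
    KnownAt k (fun ω => F ω * G ω) := fun ω ω' h h' => by
  simp only [hF ω ω' h h', hG ω ω' h h']

lemma KnownAt.mono {k k' : ℕ} (hk : k ≤ k') {F : Traj net → ℝ} (hF : KnownAt k F) :
    KnownAt k' F := fun ω ω' h h' => by
  refine hF ω ω' (fun i hi => h i (hi.trans hk)) fun n => ?_
  -- For `k < k'` the actions of slot `k` are stored at index `k + 1 ≤ k'`, hence belong to the
  -- history.
  rcases hk.eq_or_lt with rfl | hlt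
  · exact h' n
  · exact actionAt_congr (h _ hlt) n

/-- What is known once the actions of slot `k` have been drawn. -/
def knownPart (net : Network N K L) (k : ℕ) (ω : Traj net) :
    History net k × (Fin N → Action L) := (Preorder.frestrictLe k ω, fun n => actionAt ω n k)

lemma measurable_actionAt (k : ℕ) : Measurable (fun (ω : Traj net) n => actionAt ω n k) := by
  have h : Measurable (fun y : Slot net (k + 1) =>
    (show (Fin N → Action L) × (Fin N → Fin K) from y).1) := measurable_of_finite _
  exact h.comp (measurable_pi_apply (k + 1))

lemma measurable_knownPart (k : ℕ) : Measurable (knownPart net k) :=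
  Measurable.prodMk (by fun_prop) (measurable_actionAt k)

/-- Factorization through a finite space, which makes measurability and integrability automatic. The
default value of the extension is never seen. -/
lemma KnownAt.exists_eq {k : ℕ} {F : Traj net → ℝ} (hF : KnownAt k F) :
    ∃ G : History net k × (Fin N → Action L) → ℝ, F = G ∘ knownPart net k := by
  refine ⟨Function.extend (knownPart net k) F 0, ?_⟩
  have h : Function.FactorsThrough F (knownPart net k) := fun ω ω' hω => by
    refine hF ω ω' (fun i hi => ?_) fun n => congrFun (congrArg Prod.snd hω) n
    exact congrFun (congrArg Prod.fst hω) ⟨i, Finset.mem_Iic.2 hi⟩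
  funext ω
  exact (h.extend_apply 0 ω).symm

lemma KnownAt.measurable {k : ℕ} {F : Traj net → ℝ} (hF : KnownAt k F) : Measurable F := by
  obtain ⟨G, rfl⟩ := hF.exists_eq
  exact (measurable_of_finite G).comp (measurable_knownPart k)

lemma KnownAt.integrable {k : ℕ} {F : Traj net → ℝ} (hF : KnownAt k F) (u : Policy net) :
    Integrable F (law net u) := by
  obtain ⟨G, rfl⟩ := hF.exists_eq
  have : IsProbabilityMeasure ((law net u).map (knownPart net k)) :=
    Measure.isProbabilityMeasure_map (measurable_knownPart k).aemeasurable
  exact Integrable.comp_measurable Integrable.of_finite (measurable_knownPart k)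

lemma integral_ite_eq {α : Type*} [MeasurableSpace α] [MeasurableSingletonClass α]
    [DecidableEq α] (p : PMF α) (a : α) :
    ∫ b, (if b = a then (1 : ℝ) else 0) ∂p.toMeasure = (p a).toReal := by
  have h : (fun b => if b = a then (1 : ℝ) else 0) = Set.indicator {a} 1 := by
    funext b; simp [Set.indicator]
  rw [h, integral_indicator_one (measurableSet_singleton a), Measure.real,
    PMF.toMeasure_apply_singleton _ _ (measurableSet_singleton a)]

lemma integral_ite_comp_eq {α β : Type*} [MeasurableSpace α] [MeasurableSpace β]
    [MeasurableSingletonClass β] [DecidableEq β] (p : PMF α) {f : α → β} (hf : Measurable f)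
    (b : β) : ∫ a, (if f a = b then (1 : ℝ) else 0) ∂p.toMeasure = (p.map f b).toReal := by
  have hb : Measurable fun b' => if b' = b then (1 : ℝ) else 0 :=
    Measurable.ite (measurableSet_singleton b) measurable_const measurable_const
  rw [← integral_ite_eq, ← PMF.toMeasure_map _ _ hf, integral_map hf.aemeasurable
    hb.aestronglyMeasurable]

/-- The channel of user `n` is a Markov chain with respect to the history, and its transitions do
not depend on the actions. -/
lemma integral_mul_chanAt_succ (u : Policy net) {k : ℕ} {F : Traj net → ℝ} (hF : KnownAt k F)
    (n : Fin N) (j : Fin K) :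
    ∫ ω, F ω * (if chanAt ω n (k + 1) = j then 1 else 0) ∂law net u =
      ∫ ω, F ω * ((net.user n).channel (chanAt ω n k) j).toReal ∂law net u := by
  obtain ⟨G, rfl⟩ := hF.exists_eq
  let C : History net k → PMF (Fin K) := fun h =>
    (net.user n).channel (chanOf net k (h ⟨k, Finset.mem_Iic.2 le_rfl⟩) n)
  refine (integral_law_succ u k fun h (y : (Fin N → Action L) × (Fin N → Fin K)) =>
      G (h, y.1) * (if y.2 n = j then 1 else 0)).trans
    (Eq.trans ?_ (integral_law_succ u k fun h (y : (Fin N → Action L) × (Fin N → Fin K)) =>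
      G (h, y.1) * (C h j).toReal).symm)
  congr 1 with h
  -- Given the history, actions and channel moves are independent, so the integral factors; only the
  -- `n`-th marginal of the channel moves then matters.
  have h₁ := integral_prod_mul (μ := (u k h).toMeasure) (ν := Measure.pi fun n =>
    ((net.user n).channel (chanOf net k (h ⟨k, Finset.mem_Iic.2 le_rfl⟩) n)).toMeasure)
    (fun a => G (h, a)) (fun c => if c n = j then (1 : ℝ) else 0)
  have h₂ := integral_prod_mul (μ := (u k h).toMeasure) (ν := Measure.pi fun n =>
    ((net.user n).channel (chanOf net k (h ⟨k, Finset.mem_Iic.2 le_rfl⟩) n)).toMeasure)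
    (fun a => G (h, a)) (fun _ => (C h j).toReal)
  refine h₁.trans (Eq.trans ?_ h₂.symm)
  congr 1
  rw [integral_const, probReal_univ, one_smul, ← integral_ite_eq,
    ← (measurePreserving_eval (fun n => ((net.user n).channel
      (chanOf net k (h ⟨k, Finset.mem_Iic.2 le_rfl⟩) n)).toMeasure) n).map_eq,
    integral_map (measurable_pi_apply n).aemeasurable
      (measurable_of_finite _).aestronglyMeasurable]

/-- The conditional law of the action that is drawn for user `n` in slot `k`. -/
lemma integral_mul_actionAt (u : Policy net) {k : ℕ} {F : Traj net → ℝ}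
    (hF : ∀ ω ω' : Traj net, (∀ i ≤ k, ω i = ω' i) → F ω = F ω') (n : Fin N) (a : Action L) :
    ∫ ω, F ω * (if actionAt ω n k = a then 1 else 0) ∂law net u =
      ∫ ω, F ω * ((u k (Preorder.frestrictLe k ω)).map (fun b => b n) a).toReal ∂law net u := by
  obtain ⟨G, rfl⟩ : ∃ G : History net k → ℝ, F = G ∘ Preorder.frestrictLe k := by
    refine ⟨Function.extend (Preorder.frestrictLe k) F 0, ?_⟩
    have h : Function.FactorsThrough F (Preorder.frestrictLe k) := fun ω ω' hω =>
      hF ω ω' fun i hi => congrFun hω ⟨i, Finset.mem_Iic.2 hi⟩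
    funext ω
    exact (h.extend_apply 0 ω).symm
  refine (integral_law_succ u k fun h (y : (Fin N → Action L) × (Fin N → Fin K)) =>
      G h * (if y.1 n = a then 1 else 0)).trans
    (Eq.trans ?_ (integral_law_succ u k fun h _ =>
      G h * ((u k h).map (fun b => b n) a).toReal).symm)
  congr 1 with h
  have h₁ := integral_prod_mul (μ := (u k h).toMeasure) (ν := Measure.pi fun n =>
    ((net.user n).channel (chanOf net k (h ⟨k, Finset.mem_Iic.2 le_rfl⟩) n)).toMeasure)
    (fun b => G h * (if b n = a then 1 else 0)) (fun _ => (1 : ℝ))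
  simp only [mul_one] at h₁
  refine h₁.trans ?_
  rw [integral_const, probReal_univ, one_smul, integral_const, probReal_univ, one_smul, mul_one,
    integral_const_mul, integral_ite_comp_eq _ (measurable_pi_apply n)]

end Law

/-! ### Law of the duration and of the final channel state of an action. -/

section Paths

variable {N K L : ℕ} {net : Network N K L}

lemma knownAt_of_le {k : ℕ} {F : Traj net → ℝ}
    (hF : ∀ ω ω' : Traj net, (∀ i ≤ k, ω i = ω' i) → F ω = F ω') : KnownAt k F :=
  fun ω ω' h _ => hF ω ω' h

/-- The probability that the channel of user `n` follows a given path. -/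
lemma integral_mul_path (u : Policy net) {k : ℕ} {F : Traj net → ℝ} (hF : KnownAt k F)
    (n : Fin N) (t : ℕ) (w : Fin (t + 1) → Fin K) :
    ∫ ω, F ω * (if ∀ i : Fin (t + 1), chanAt ω n (k + i) = w i then 1 else 0) ∂law net u =
      (∫ ω, F ω * (if chanAt ω n k = w 0 then 1 else 0) ∂law net u) *
        ∏ i : Fin t, ((net.user n).channel (w i.castSucc) (w i.succ)).toReal := by
  induction t with
  | zero => simp
  | succ t ih =>
    have ih := ih (fun i => w i.castSucc)
    rw [Fin.prod_univ_castSucc, ← mul_assoc]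
    -- The path up to slot `k + t` is known there, so the last transition can be split off by the
    -- Markov property.
    have hF' : KnownAt (k + t) (fun ω => F ω *
        (if ∀ i : Fin (t + 1), chanAt ω n (k + i) = w i.castSucc then 1 else 0)) :=
      (hF.mono (Nat.le_add_right k t)).mul (knownAt_of_le fun ω ω' h => by
        have : ∀ i : Fin (t + 1), chanAt ω n (k + i) = chanAt ω' n (k + i) := fun i =>
          chanAt_congr (h _ (by omega)) n
        simp only [this])
    have h₁ := integral_mul_chanAt_succ u hF' n (w (Fin.last (t + 1)))
    calc _ = ∫ ω, F ω * (if ∀ i : Fin (t + 1), chanAt ω n (k + i) = w i.castSucc then 1 else 0) *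
          (if chanAt ω n (k + t + 1) = w (Fin.last (t + 1)) then 1 else 0) ∂law net u := by
          congr 1 with ω
          simp only [Fin.forall_fin_succ' (n := t + 1), Fin.val_castSucc, Fin.val_last]
          rw [mul_assoc, ← add_assoc]
          by_cases hp : ∀ i : Fin (t + 1), chanAt ω n (k + i) = w i.castSucc <;>
            by_cases hq : chanAt ω n (k + t + 1) = w (Fin.last (t + 1)) <;> simp [hp, hq]
      _ = ∫ ω, F ω * (if ∀ i : Fin (t + 1), chanAt ω n (k + i) = w i.castSucc then 1 else 0) *
          ((net.user n).channel (w (Fin.last t).castSucc) (w (Fin.last t).succ)).toReal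
            ∂law net u := by
          rw [h₁]
          congr 1 with ω
          by_cases hp : ∀ i : Fin (t + 1), chanAt ω n (k + i) = w i.castSucc
          · have := hp (Fin.last t)
            rw [Fin.val_last] at this
            rw [this, Fin.succ_last]
          · simp [hp]
      _ = _ := by
          rw [integral_mul_const, ih]
          rfl

/-- The joint law of the duration of an action and of the channel state at its end. -/
lemma integral_mul_duration (u : Policy net) {k : ℕ} {F : Traj net → ℝ} (hF : KnownAt k F)
    {n : Fin N} {c : Fin K} (hc : ∀ ω, F ω ≠ 0 → chanAt ω n k = c) (a : Action L) (t : ℕ)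
    (j : Fin K) :
    ∫ ω, F ω * (if duration net n a (fun i => chanAt ω n (k + i)) = t ∧ chanAt ω n (k + t) = j
      then 1 else 0) ∂law net u = (∫ ω, F ω ∂law net u) * durProb net n a c t j := by
  have hpt : ∀ ω, F ω * (if duration net n a (fun i => chanAt ω n (k + i)) = t ∧
      chanAt ω n (k + t) = j then 1 else 0) = ∑ w : Fin (t + 1) → Fin K,
      F ω * (if ∀ i : Fin (t + 1), chanAt ω n (k + i) = w i then 1 else 0) *
      (if w 0 = c ∧ w (Fin.last t) = j ∧
        duration net n a (fun i => w ⟨min i t, by omega⟩) = t then 1 else 0) := by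
    intro ω
    rcases eq_or_ne (F ω) 0 with h0 | h0
    · simp [h0]
    rw [Finset.sum_eq_single (fun i : Fin (t + 1) => chanAt ω n (k + i))]
    -- Freezing the path after time `t`, as `durProb` does, cannot affect whether the duration is
    -- `t`.
    · have hd : duration net n a (fun i => chanAt ω n (k + min i t)) = t ↔
          duration net n a (fun i => chanAt ω n (k + i)) = t :=
        duration_eq_iff_of_eq net n a fun i hi => by rw [min_eq_left hi.le]
      simp only [Fin.val_last, Fin.val_zero, add_zero, hc ω h0, hd, true_and, implies_true,
        if_true, mul_one]
      simp only [and_comm]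
    · intro w _ hw
      rw [if_neg, mul_zero, zero_mul]
      exact fun h => hw (funext fun i => (h i).symm)
    · simp
  have hpath : ∀ w : Fin (t + 1) → Fin K, KnownAt (k + t) (fun ω => F ω *
      (if ∀ i : Fin (t + 1), chanAt ω n (k + i) = w i then 1 else 0)) := fun w =>
    (hF.mono (Nat.le_add_right k t)).mul (knownAt_of_le fun ω ω' h => by
      have : ∀ i : Fin (t + 1), chanAt ω n (k + i) = chanAt ω' n (k + i) := fun i =>
        chanAt_congr (h _ (by omega)) n
      simp only [this])
  simp_rw [hpt]
  rw [integral_finsetSum _ fun w _ => ((hpath w).integrable u).mul_const _, durProb,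
    Finset.mul_sum]
  refine Finset.sum_congr rfl fun w _ => ?_
  rw [integral_mul_const, integral_mul_path u hF]
  split_ifs with hw
  · rw [mul_one, hw.1]
    congr 2 with ω
    rcases eq_or_ne (F ω) 0 with h0 | h0
    · simp [h0]
    · simp [hc ω h0]
  · simp

lemma durProb_nonneg (n : Fin N) (a : Action L) (c : Fin K) (t : ℕ) (j : Fin K) :
    0 ≤ durProb net n a c t j :=
  Finset.sum_nonneg fun w _ => by
    split_ifs
    · exact Finset.prod_nonneg fun i _ => ENNReal.toReal_nonneg
    · exact le_rfl

lemma durProb_eq_zero {T : ℕ} {n : Fin N} {a : Action L}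
    (hT : ∀ c : ℕ → Fin K, duration net n a c ≤ T) (c : Fin K) {t : ℕ} (ht : T < t) (j : Fin K) :
    durProb net n a c t j = 0 :=
  Finset.sum_eq_zero fun w _ => if_neg fun h => by
    have := hT (fun i => w ⟨min i t, by omega⟩)
    omega

lemma integral_initial (u : Policy net) (n : Fin N) (f : (net.user n).S → ℝ) :
    ∫ ω, f ((show ∀ n, (net.user n).S from ω 0) n) ∂law net u =
      ∫ x, f x ∂(net.user n).init.toMeasure := by
  have hf : Measurable f := measurable_of_finite f
  have h₁ : ∫ y : Slot net 0, f ((show ∀ n, (net.user n).S from y) n) ∂initMeasure net =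
      ∫ ω, f ((show ∀ n, (net.user n).S from ω 0) n) ∂law net u := by
    rw [← law_map_zero u, integral_map (measurable_pi_apply 0).aemeasurable]
    exact (measurable_of_finite _).aestronglyMeasurable
  rw [← h₁, ← (measurePreserving_eval (fun n => (net.user n).init.toMeasure) n).map_eq,
    integral_map (measurable_pi_apply n).aemeasurable hf.aestronglyMeasurable]
  rfl

/-- The network in which all channels start in state `c`. -/
noncomputable def startAt (net : Network N K L) (c : Fin K) : Network N K L :=
  { net with user := fun n =>
      { net.user n with init := (net.user n).init.map fun x => (c, x.2) } }

/-- The law of duration and final channel state has total mass one. -/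
lemma sum_durProb {T : ℕ} {n : Fin N} {a : Action L}
    (hT : ∀ c : ℕ → Fin K, duration net n a c ≤ T) (c : Fin K) :
    ∑ t ∈ Finset.range (T + 1), ∑ j, durProb net n a c t j = 1 := by
  -- The weights do not involve the initial laws, so they may be realized as probabilities in a
  -- network whose channels start in `c` almost surely; there every trajectory has exactly one
  -- duration and one final state. The policy is immaterial.
  let net' := startAt net c
  let u : Policy net' := fun _ _ => PMF.pure 0
  let F : Traj net' → ℝ := fun ω => if chanAt ω n 0 = c then 1 else 0
  have hF : KnownAt 0 F := knownAt_of_le fun ω ω' h => by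
    simp only [F, chanAt_congr (h 0 le_rfl)]
  have hFc : ∀ ω, F ω ≠ 0 → chanAt ω n 0 = c := fun ω h => by
    by_contra h'
    exact h (if_neg h')
  have hint : ∫ ω, F ω ∂law net' u = 1 := by
    refine (integral_initial u n fun x => if x.1 = c then 1 else 0).trans ?_
    refine (integral_ite_comp_eq _ measurable_fst c).trans ?_
    change (((net.user n).init.map fun x => (c, x.2)).map Prod.fst c).toReal = 1
    rw [PMF.map_comp]
    change ((net.user n).init.map (Function.const _ c) c).toReal = 1
    rw [PMF.map_const]
    simp
  have key : ∀ t j, ∫ ω, F ω * (if duration net' n a (fun i => chanAt ω n (0 + i)) = t ∧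
      chanAt ω n (0 + t) = j then 1 else 0) ∂law net' u = durProb net n a c t j := fun t j => by
    rw [integral_mul_duration u hF hFc, hint, one_mul]
    rfl
  have hk : ∀ t j, KnownAt (net := net') t fun ω => F ω *
      (if duration net' n a (fun i => chanAt ω n (0 + i)) = t ∧
        chanAt ω n (0 + t) = j then 1 else 0) := fun t j =>
    (hF.mono (Nat.zero_le t)).mul (knownAt_of_le fun ω ω' h => by
      have h₁ : duration net' n a (fun i => chanAt ω n (0 + i)) = t ↔
          duration net' n a (fun i => chanAt ω' n (0 + i)) = t :=
        duration_eq_iff_of_eq net' n a fun i hi => chanAt_congr (h _ (by omega)) n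
      have h₂ : chanAt ω n (0 + t) = chanAt ω' n (0 + t) := chanAt_congr (h _ (by omega)) n
      simp only [h₁, h₂])
  simp_rw [← key]
  simp_rw [← integral_finsetSum _ fun j _ => (hk _ j).integrable u]
  rw [← integral_finsetSum _ fun t _ => integrable_finsetSum _ fun j _ => (hk t j).integrable u]
  refine Eq.trans ?_ hint
  congr 1 with ω
  simp_rw [← Finset.mul_sum]
  rw [Finset.sum_eq_single (duration net' n a (fun i => chanAt ω n (0 + i)))]
  · simp
  · intro t _ ht
    exact Finset.sum_eq_zero fun j _ => if_neg fun h => ht h.1.symm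
  · intro h
    exact absurd (Finset.mem_range.2 (Nat.lt_succ_of_le (hT _))) h

end Paths

/-! ### Expectations of discounted sums over decisions. -/

lemma integrable_geometric_tsum {Ω : Type*} [MeasurableSpace Ω] {μ : Measure Ω}
    [IsProbabilityMeasure μ] {β : ℝ} (h0 : 0 ≤ β) (h1 : β < 1) {X : ℕ → Ω → ℝ}
    (hX : ∀ k, Measurable (X k)) (hb : ∀ k ω, |X k ω| ≤ 1) :
    Integrable (fun ω => ∑' k, β ^ k * X k ω) μ ∧
      ∫ ω, ∑' k, β ^ k * X k ω ∂μ = ∑' k, β ^ k * ∫ ω, X k ω ∂μ := by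
  have hgeo := hasSum_geometric_of_lt_one h0 h1
  have hle : ∀ k ω, ‖β ^ k * X k ω‖ ≤ β ^ k := fun k ω => by
    rw [norm_mul, Real.norm_of_nonneg (pow_nonneg h0 k)]
    exact mul_le_of_le_one_right (pow_nonneg h0 k) (hb k ω)
  have hint : ∀ k, Integrable (fun ω => β ^ k * X k ω) μ := fun k =>
    Integrable.of_bound ((hX k).const_mul _).aestronglyMeasurable (β ^ k)
      (Filter.Eventually.of_forall (hle k))
  constructor
  · refine Integrable.of_bound (Measurable.aestronglyMeasurable ?_) (1 - β)⁻¹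
      (Filter.Eventually.of_forall fun ω => tsum_of_norm_bounded hgeo (hle · ω))
    refine measurable_of_tendsto_metrizable (f := fun m ω => ∑ k ∈ Finset.range m, β ^ k * X k ω)
      (fun m => Finset.measurable_fun_sum _ fun k _ => (hX k).const_mul _)
      (tendsto_pi_nhds.2 fun ω => ?_)
    exact (Summable.of_norm_bounded hgeo.summable (hle · ω)).hasSum.tendsto_sum_nat
  · rw [← integral_tsum_of_summable_integral_norm hint]
    · simp_rw [integral_const_mul]
    · refine Summable.of_nonneg_of_le (fun k => integral_nonneg fun ω => norm_nonneg _) (fun k => ?_)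
        hgeo.summable
      calc _ ≤ ∫ _, β ^ k ∂μ := integral_mono (hint k).norm (integrable_const _) (hle k)
        _ = β ^ k := by simp

section Decisions

variable {N K L : ℕ} {net : Network N K L}

/-- The mean of a function of the duration of action `a` and of the channel state at its end. -/
noncomputable def durMean (net : Network N K L) (n : Fin N) (a : Action L) (c : Fin K)
    (h : ℕ → Fin K → ℝ) : ℝ :=
  ∑' t, ∑ j, durProb net n a c t j * h t j

lemma durMean_eq_sum {T : ℕ} {n : Fin N} {a : Action L}
    (hT : ∀ c : ℕ → Fin K, duration net n a c ≤ T) (c : Fin K) (h : ℕ → Fin K → ℝ) :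
    durMean net n a c h = ∑ t ∈ Finset.range (T + 1), ∑ j, durProb net n a c t j * h t j :=
  tsum_eq_sum fun t ht => Finset.sum_eq_zero fun j _ => by
    rw [durProb_eq_zero hT c (by simpa using ht), zero_mul]

lemma durMean_const (n : Fin N) (a : Action L) (c : Fin K) (r : ℝ) :
    durMean net n a c (fun _ _ => r) = r := by
  obtain ⟨T, hT⟩ := exists_duration_le net
  rw [durMean_eq_sum (hT n a)]
  simp_rw [← Finset.sum_mul]
  rw [sum_durProb (hT n a), one_mul]

lemma durMean_mono {n : Fin N} {a : Action L} {c : Fin K} {h h' : ℕ → Fin K → ℝ}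
    (hh : ∀ t j, durProb net n a c t j ≠ 0 → h t j ≤ h' t j) :
    durMean net n a c h ≤ durMean net n a c h' := by
  obtain ⟨T, hT⟩ := exists_duration_le net
  rw [durMean_eq_sum (hT n a), durMean_eq_sum (hT n a)]
  refine Finset.sum_le_sum fun t _ => Finset.sum_le_sum fun j _ => ?_
  rcases eq_or_ne (durProb net n a c t j) 0 with h0 | h0
  · simp [h0]
  · exact mul_le_mul_of_nonneg_left (hh t j h0) (durProb_nonneg ..)

lemma durMean_const_mul_add (n : Fin N) (a : Action L) (c : Fin K) (r : ℝ)
    (h h' : ℕ → Fin K → ℝ) : durMean net n a c (fun t j => r * h t j + h' t j) =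
      r * durMean net n a c h + durMean net n a c h' := by
  obtain ⟨T, hT⟩ := exists_duration_le net
  simp_rw [durMean_eq_sum (hT n a), Finset.mul_sum, ← Finset.sum_add_distrib]
  exact Finset.sum_congr rfl fun t _ => Finset.sum_congr rfl fun j _ => by ring

lemma durMean_sum {ι : Type*} [Fintype ι] (n : Fin N) (a : Action L) (c : Fin K)
    (h : ι → ℕ → Fin K → ℝ) :
    durMean net n a c (fun t j => ∑ i, h i t j) = ∑ i, durMean net n a c (h i) := by
  obtain ⟨T, hT⟩ := exists_duration_le net
  simp_rw [durMean_eq_sum (hT n a), Finset.mul_sum]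
  rw [Finset.sum_comm (s := (Finset.univ : Finset ι))]
  exact Finset.sum_congr rfl fun t _ => Finset.sum_comm

variable [NeZero L]

/-- The discounted contribution of the `m`-th decision of user `n` to a functional `g` of state,
action, duration, and final channel state. -/
noncomputable def decTerm (s : ℝ) (ω : Traj net) (n : Fin N)
    (g : (net.user n).S → Action L → ℕ → Fin K → ℝ) (m : ℕ) : ℝ :=
  Real.exp (-s) ^ decSlot ω n m *
    g (decState ω n m) (decAction ω n m) (decDur ω n m) (chanAt ω n (decSlot ω n (m + 1)))

lemma exp_neg_lt_one {s : ℝ} (hs : 0 < s) : Real.exp (-s) < 1 := by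
  rw [Real.exp_lt_one_iff]; linarith

/-- The `m`-th decision is not made before slot `m`, and `g` is evaluated at finitely many arguments
because durations are bounded; a geometric series dominates. -/
lemma summable_decTerm {s : ℝ} (hs : 0 < s) (ω : Traj net) (n : Fin N)
    (g : (net.user n).S → Action L → ℕ → Fin K → ℝ) : Summable (decTerm s ω n g) := by
  obtain ⟨T, hT⟩ := exists_duration_le net
  let B : ℝ := ∑ p : (net.user n).S × Action L × Fin (T + 1) × Fin K,
    |g p.1 p.2.1 p.2.2.1 p.2.2.2|
  refine Summable.of_norm_bounded (g := fun m => Real.exp (-s) ^ m * B)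
    ((summable_geometric_of_lt_one (Real.exp_pos _).le (exp_neg_lt_one hs)).mul_right B)
    fun m => ?_
  rw [decTerm, norm_mul, Real.norm_of_nonneg (pow_nonneg (Real.exp_pos _).le _)]
  refine mul_le_mul (pow_le_pow_of_le_one (Real.exp_pos _).le (exp_neg_lt_one hs).le
    ((decSlot_strictMono ω n).id_le m)) ?_ (norm_nonneg _) (pow_nonneg (Real.exp_pos _).le _)
  exact Finset.single_le_sum
    (f := fun p : (net.user n).S × Action L × Fin (T + 1) × Fin K =>
      |g p.1 p.2.1 p.2.2.1 p.2.2.2|) (fun _ _ => abs_nonneg _)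
    (Finset.mem_univ (decState ω n m, decAction ω n m,
      (⟨decDur ω n m, Nat.lt_succ_of_le (hT n _ _)⟩ : Fin (T + 1)),
      chanAt ω n (decSlot ω n (m + 1))))

open Classical in
lemma indicator_decSlot (ω : Traj net) (n : Fin N) (x : (net.user n).S) (a : Action L) (m : ℕ) :
    indicator ω n x a (decSlot ω n m) =
      if decState ω n m = x ∧ decAction ω n m = a then 1 else 0 := by
  rw [indicator]
  refine if_congr ⟨?_, fun h => ⟨m, rfl, h⟩⟩ rfl rfl
  rintro ⟨m', hm', h⟩
  rwa [(decSlot_strictMono ω n).injective hm'] at h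

/-- Sums over decisions are sums over slots. -/
lemma tsum_indicator_mul (s : ℝ) (ω : Traj net) (n : Fin N) (x : (net.user n).S) (a : Action L)
    (h : ℕ → ℝ) :
    ∑' k, Real.exp (-s) ^ k * (indicator ω n x a k * h k) =
      ∑' m, Real.exp (-s) ^ decSlot ω n m *
        (indicator ω n x a (decSlot ω n m) * h (decSlot ω n m)) := by
  refine ((decSlot_strictMono ω n).injective.tsum_eq
    (f := fun k => Real.exp (-s) ^ k * (indicator ω n x a k * h k)) fun k hk => ?_).symm
  by_contra hk'
  refine hk ?_
  -- Slots without a decision contribute nothing.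
  have : indicator ω n x a k = 0 := if_neg fun ⟨m, hm, _⟩ => hk' ⟨m, hm⟩
  simp [this]

lemma knownAt_indicator (n : Fin N) (x : (net.user n).S) (a : Action L) (k : ℕ) :
    KnownAt k (fun ω : Traj net => indicator ω n x a k) := fun ω ω' h h' => by
  simp only [indicator_eq, h']
  have hd := decidesIn_congr h n x
  by_cases hω : DecidesIn ω n x k
  · simp only [if_pos hω, if_pos (hd.1 hω)]
  · simp only [if_neg hω, if_neg (fun h => hω (hd.2 h))]

lemma indicator_nonneg (ω : Traj net) (n : Fin N) (x : (net.user n).S) (a : Action L) (k : ℕ) :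
    0 ≤ indicator ω n x a k := by
  rw [indicator]; split_ifs <;> norm_num

lemma indicator_le_one (ω : Traj net) (n : Fin N) (x : (net.user n).S) (a : Action L) (k : ℕ) :
    indicator ω n x a k ≤ 1 := by
  rw [indicator]; split_ifs <;> norm_num

lemma integrable_visits {s : ℝ} (hs : 0 < s) (u : Policy net) (n : Fin N) (x : (net.user n).S)
    (a : Action L) : Integrable (fun ω => visits s ω n x a) (law net u) :=
  (integrable_geometric_tsum (Real.exp_pos _).le (exp_neg_lt_one hs)
    (fun k => (knownAt_indicator n x a k).measurable)
    (fun _ _ => by rw [abs_of_nonneg (indicator_nonneg ..)]; exact indicator_le_one ..)).1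

lemma occupation_eq_tsum {s : ℝ} (hs : 0 < s) (u : Policy net) (n : Fin N) (x : (net.user n).S)
    (a : Action L) : occupation s u n x a =
      ∑' k, Real.exp (-s) ^ k * ∫ ω, indicator ω n x a k ∂law net u :=
  (integrable_geometric_tsum (Real.exp_pos _).le (exp_neg_lt_one hs)
    (fun k => (knownAt_indicator n x a k).measurable)
    (fun _ _ => by rw [abs_of_nonneg (indicator_nonneg ..)]; exact indicator_le_one ..)).2

lemma occupation_nonneg (s : ℝ) (u : Policy net) (n : Fin N) (x : (net.user n).S)
    (a : Action L) : 0 ≤ occupation s u n x a :=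
  integral_nonneg fun _ => tsum_nonneg fun _ =>
    mul_nonneg (pow_nonneg (Real.exp_pos _).le _) (indicator_nonneg ..)

/-- The expectation of a discounted sum over the decisions at which user `n` is assigned `a` in
`x`, the action takes `t` slots, and the channel state at its end is `j`. -/
lemma integral_tsum_duration {s : ℝ} (hs : 0 < s) (u : Policy net) (n : Fin N)
    (x : (net.user n).S) (a : Action L) (t : ℕ) (j : Fin K) :
    Integrable (fun ω : Traj net => ∑' k, Real.exp (-s) ^ k * (indicator ω n x a k *
      (if duration net n a (fun i => chanAt ω n (k + i)) = t ∧ chanAt ω n (k + t) = j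
        then 1 else 0))) (law net u) ∧
    ∫ ω : Traj net, ∑' k, Real.exp (-s) ^ k * (indicator ω n x a k *
      (if duration net n a (fun i => chanAt ω n (k + i)) = t ∧ chanAt ω n (k + t) = j
        then 1 else 0)) ∂law net u = occupation s u n x a * durProb net n a x.1 t j := by
  have hk : ∀ k, KnownAt (k + t) fun ω : Traj net => indicator ω n x a k *
      (if duration net n a (fun i => chanAt ω n (k + i)) = t ∧ chanAt ω n (k + t) = j
        then 1 else 0) := fun k =>
    ((knownAt_indicator n x a k).mono (Nat.le_add_right k t)).mul
      (knownAt_of_le fun ω ω' h => by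
        have h₁ : duration net n a (fun i => chanAt ω n (k + i)) = t ↔
            duration net n a (fun i => chanAt ω' n (k + i)) = t :=
          duration_eq_iff_of_eq net n a fun i hi => chanAt_congr (h _ (by omega)) n
        have h₂ : chanAt ω n (k + t) = chanAt ω' n (k + t) := chanAt_congr (h _ le_rfl) n
        simp only [h₁, h₂])
  obtain ⟨h₁, h₂⟩ := integrable_geometric_tsum (μ := law net u) (Real.exp_pos _).le
    (exp_neg_lt_one hs) (fun k => (hk k).measurable) (fun _ _ => by
      split_ifs
      · rw [mul_one, abs_of_nonneg (indicator_nonneg ..)]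
        exact indicator_le_one ..
      · simp)
  refine ⟨h₁, h₂.trans ?_⟩
  rw [occupation_eq_tsum hs, ← tsum_mul_right]
  congr 1 with k
  rw [mul_assoc, integral_mul_duration u (knownAt_indicator n x a k)]
  -- Where the indicator is nonzero, the user decides in `x`, which fixes the channel state to
  -- `x.1`.
  intro ω hω
  rw [indicator_eq] at hω
  by_contra hne
  exact hω (by rw [if_neg fun h => hne h.chanAt_eq, zero_mul])

/-- The expectation of a discounted sum over all decisions. -/
lemma integral_tsum_decTerm {s : ℝ} (hs : 0 < s) (u : Policy net) (n : Fin N)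
    (g : (net.user n).S → Action L → ℕ → Fin K → ℝ) :
    Integrable (fun ω => ∑' m, decTerm s ω n g m) (law net u) ∧
    ∫ ω, ∑' m, decTerm s ω n g m ∂law net u =
      ∑ x, ∑ a, occupation s u n x a * durMean net n a x.1 (g x a) := by
  obtain ⟨T, hT⟩ := exists_duration_le net
  -- Sort the decisions by the finitely many possible values of state, action, duration and final
  -- channel state; `g` is constant on each class.
  have hpt : ∀ ω : Traj net, ∑' m, decTerm s ω n g m =
      ∑ p : (net.user n).S × Action L × Fin (T + 1) × Fin K, g p.1 p.2.1 p.2.2.1 p.2.2.2 *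
        ∑' k, Real.exp (-s) ^ k * (indicator ω n p.1 p.2.1 k *
        (if duration net n p.2.1 (fun i => chanAt ω n (k + i)) = p.2.2.1 ∧
          chanAt ω n (k + p.2.2.1) = p.2.2.2 then 1 else 0)) := by
    intro ω
    have hp : ∀ p : (net.user n).S × Action L × Fin (T + 1) × Fin K,
        g p.1 p.2.1 p.2.2.1 p.2.2.2 *
        ∑' k, Real.exp (-s) ^ k * (indicator ω n p.1 p.2.1 k *
        (if duration net n p.2.1 (fun i => chanAt ω n (k + i)) = p.2.2.1 ∧
          chanAt ω n (k + p.2.2.1) = p.2.2.2 then 1 else 0)) =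
        ∑' m, decTerm s ω n (fun x a t j => if (x, a, t, j) = (p.1, p.2.1, (p.2.2.1 : ℕ), p.2.2.2)
          then g p.1 p.2.1 p.2.2.1 p.2.2.2 else 0) m := by
      rintro ⟨x, a, t, j⟩
      rw [tsum_indicator_mul, ← tsum_mul_left]
      congr 1 with m
      rw [indicator_decSlot, decTerm, mul_left_comm]
      congr 1
      by_cases h : decState ω n m = x ∧ decAction ω n m = a
      · obtain ⟨rfl, rfl⟩ := h
        change _ * (_ * if decDur ω n m = t ∧ _ then 1 else 0) = _
        by_cases ht : decDur ω n m = t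
        · by_cases hj : chanAt ω n (decSlot ω n m + t) = j
          · simp [ht, hj, decSlot_succ]
          · simp [ht, hj, decSlot_succ]
        · simp [ht]
      · rw [if_neg h, zero_mul, mul_zero, if_neg fun h' => ?_]
        simp only [Prod.mk.injEq] at h'
        exact h ⟨h'.1, h'.2.1⟩
    simp_rw [hp]
    rw [← Summable.tsum_finsetSum fun p _ => summable_decTerm hs ω n _]
    congr 1 with m
    simp_rw [decTerm]
    rw [← Finset.mul_sum]
    congr 1
    rw [Finset.sum_eq_single (decState ω n m, decAction ω n m,
      (⟨decDur ω n m, Nat.lt_succ_of_le (hT n _ _)⟩ : Fin (T + 1)),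
      chanAt ω n (decSlot ω n (m + 1)))]
    · simp
    · rintro ⟨x, a, t, j⟩ _ hne
      refine if_neg fun h => hne ?_
      simp only [Prod.mk.injEq] at h ⊢
      exact ⟨h.1.symm, h.2.1.symm, Fin.ext h.2.2.1.symm, h.2.2.2.symm⟩
    · simp
  simp_rw [hpt]
  refine ⟨integrable_finsetSum _ fun p _ => (integral_tsum_duration hs u n _ _ _ _).1.const_mul _, ?_⟩
  rw [integral_finsetSum _ fun p _ => (integral_tsum_duration hs u n _ _ _ _).1.const_mul _]
  simp_rw [integral_const_mul, (integral_tsum_duration hs u n _ _ _ _).2]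
  rw [Fintype.sum_prod_type]
  refine Finset.sum_congr rfl fun x _ => ?_
  rw [Fintype.sum_prod_type]
  refine Finset.sum_congr rfl fun a _ => ?_
  rw [Fintype.sum_prod_type, durMean_eq_sum (hT n a), Finset.sum_range, Finset.mul_sum]
  refine Finset.sum_congr rfl fun t _ => ?_
  rw [Finset.mul_sum]
  refine Finset.sum_congr rfl fun j _ => by ring

end Decisions

/-! ### Double counting of occupied slots. -/

/-- Discounted numbers of intervals `[σ m, σ m + d m)` that cover a slot, summed over the slots or over
the intervals. -/
lemma tsum_pow_mul_ncard {β : ℝ} (h0 : 0 ≤ β) {σ : ℕ → ℕ} (hσ : ∀ m, m ≤ σ m) (d : ℕ → ℕ)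
    (A : ℕ → Prop) [DecidablePred A]
    (hs : Summable fun m => β ^ σ m * if A m then ∑ k ∈ Finset.range (d m), β ^ k else 0) :
    (Summable fun k => β ^ k * (Set.ncard {m | A m ∧ σ m ≤ k ∧ k < σ m + d m} : ℝ)) ∧
    ∑' k, β ^ k * (Set.ncard {m | A m ∧ σ m ≤ k ∧ k < σ m + d m} : ℝ) =
      ∑' m, β ^ σ m * if A m then ∑ k ∈ Finset.range (d m), β ^ k else 0 := by
  -- The two sides are the iterated sums of this nonnegative array, so summability of one order
  -- permits the interchange.
  obtain ⟨f, hf⟩ : ∃ f : ℕ → ℕ → ℝ, ∀ m k,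
      f m k = if A m ∧ σ m ≤ k ∧ k < σ m + d m then β ^ k else 0 := ⟨_, fun _ _ => rfl⟩
  have hrow : ∀ m, HasSum (f m)
      (β ^ σ m * if A m then ∑ k ∈ Finset.range (d m), β ^ k else 0) := fun m => by
    have h : HasSum (f m) (∑ k ∈ Finset.Ico (σ m) (σ m + d m), f m k) :=
      hasSum_sum_of_ne_finset_zero fun k hk =>
        (hf m k).trans (if_neg fun h => hk (Finset.mem_Ico.2 h.2))
    convert h using 1
    rw [Finset.sum_Ico_eq_sum_range, Nat.add_sub_cancel_left]
    by_cases ha : A m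
    · rw [if_pos ha, Finset.mul_sum]
      refine Finset.sum_congr rfl fun i hi => ?_
      have := Finset.mem_range.1 hi
      rw [hf, if_pos ⟨ha, by omega, by omega⟩, pow_add]
    · simp [hf, ha]
  have hcol : ∀ k, ∑' m, f m k =
      β ^ k * (Set.ncard {m | A m ∧ σ m ≤ k ∧ k < σ m + d m} : ℝ) := fun k => by
    -- Since `m ≤ σ m`, only finitely many intervals can cover slot `k`.
    have hle : ∀ m, σ m ≤ k → m ∈ Finset.range (k + 1) := fun m hm =>
      Finset.mem_range.2 (Nat.lt_succ_of_le ((hσ m).trans hm))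
    rw [tsum_eq_sum (s := Finset.range (k + 1)) fun m hm =>
      (hf m k).trans (if_neg fun h => hm (hle m h.2.1))]
    simp_rw [hf]
    rw [← Finset.sum_filter, Finset.sum_const, nsmul_eq_mul, mul_comm, ← Set.ncard_coe_finset]
    congr 3
    ext m
    simp only [Finset.coe_filter, Set.mem_ofPred_eq]
    exact ⟨fun h => h.2, fun h => ⟨hle m h.2.1, h⟩⟩
  have hsum : Summable (Function.uncurry f) := by
    refine (summable_prod_of_nonneg fun p => ?_).2 ⟨fun m => (hrow m).summable, ?_⟩
    · rw [Function.uncurry, hf]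
      split_ifs
      exacts [pow_nonneg h0 _, le_rfl]
    · exact hs.congr fun m => ((hrow m).tsum_eq).symm
  have hswap : Summable (Function.uncurry fun k m => f m k) := hsum.prod_symm
  have h₁ : Summable fun k => ∑' m, f m k := hswap.prod
  have h₂ : ∑' k, ∑' m, f m k = ∑' m, ∑' k, f m k := hsum.tsum_comm
  rw [tsum_congr fun m => (hrow m).tsum_eq] at h₂
  rw [funext hcol] at h₁ h₂
  exact ⟨h₁, h₂⟩

/-! ### Coefficients of the linear program as means over the duration. -/

section Coefficients

variable {N K L : ℕ} (net : Network N K L)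

lemma rbar_eq [NeZero L] (s : ℝ) (ε : ℕ) (n : Fin N) (x : (net.user n).S) (a : Action L) :
    rbar net s ε n x a = durMean net n a x.1 fun t _ =>
      ∑ k ∈ Finset.range (t + ε), Real.exp (-s) ^ k * reward (net.user n) x k :=
  tsum_congr fun t => Finset.sum_congr rfl fun j _ => by rw [← Finset.sum_mul, mul_comm]

lemma taubar_eq (s : ℝ) (ε : ℕ) (n : Fin N) (x : (net.user n).S) (a : Action L) :
    taubar net s ε n x a = durMean net n a x.1 fun t _ =>
      ∑ k ∈ Finset.range (t + ε), Real.exp (-s) ^ k :=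
  tsum_congr fun t => Finset.sum_congr rfl fun j _ => by rw [← Finset.sum_mul, mul_comm]

/-- Average `1 - β ^ t = (1 - β) * ∑ k < t, β ^ k` with `β = exp (-s)`; charging `ε` further slots
only enlarges the right-hand side. -/
lemma one_sub_durMean_pow_le {s : ℝ} (hs : Real.exp (-s) ≤ 1) (ε : ℕ) (n : Fin N) (a : Action L)
    (x : (net.user n).S) :
    1 - durMean net n a x.1 (fun t _ => Real.exp (-s) ^ t) ≤
      (1 - Real.exp (-s)) * taubar net s ε n x a := by
  rw [taubar_eq, sub_le_iff_le_add, ← durMean_const_mul_add]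
  refine (durMean_const (net := net) n a x.1 1).symm.trans_le (durMean_mono fun t _ _ => ?_)
  have hgeo := mul_neg_geom_sum (Real.exp (-s)) t
  have hε : ∑ k ∈ Finset.range t, Real.exp (-s) ^ k ≤
      ∑ k ∈ Finset.range (t + ε), Real.exp (-s) ^ k :=
    Finset.sum_le_sum_of_subset_of_nonneg (Finset.range_mono (Nat.le_add_right t ε))
      fun k _ _ => pow_nonneg (Real.exp_pos _).le _
  have := mul_le_mul_of_nonneg_left hε (sub_nonneg.2 hs)
  linarith

variable [NeZero L]

lemma matH_eq (s : ℝ) (n : Fin N) (a : Action L) (x y : (net.user n).S) :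
    matH net s n a x y = durMean net n a x.1 fun t j =>
      if (j, nextPlay (net.user n) a t x.2) = y then Real.exp (-s) ^ t else 0 := by
  refine tsum_congr fun t => ?_
  rw [Finset.sum_eq_single y.1]
  · simp only [policyMatrix, Matrix.of_apply, Prod.ext_iff (y := y), true_and]
    split_ifs <;> ring
  · intro j _ hj
    simp only [Prod.ext_iff (y := y), hj, false_and, if_false, mul_zero]
  · simp

lemma matH_nonneg (s : ℝ) (n : Fin N) (a : Action L) (x y : (net.user n).S) :
    0 ≤ matH net s n a x y := by
  rw [matH_eq]
  refine (durMean_const (net := net) n a x.1 0).symm.trans_le (durMean_mono fun t j _ => ?_)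
  split_ifs
  · exact pow_nonneg (Real.exp_pos _).le _
  · exact le_refl (0 : ℝ)

lemma durProb_zero (n : Fin N) (a : Action L) (c j : Fin K) : durProb net n a c 0 j = 0 :=
  Finset.sum_eq_zero fun _ _ => if_neg fun h => (duration_pos net n a _).ne' h.2.2

lemma sum_matH (s : ℝ) (n : Fin N) (a : Action L) (x : (net.user n).S) :
    ∑ y, matH net s n a x y = durMean net n a x.1 fun t _ => Real.exp (-s) ^ t := by
  simp_rw [matH_eq]
  rw [← durMean_sum]
  simp

/-- Duration zero has probability zero. With `sum_matH` this makes the discounted transition matrix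
a strict contraction. -/
lemma durMean_pow_le {s : ℝ} (hs : 0 < s) (n : Fin N) (a : Action L) (c : Fin K) :
    durMean net n a c (fun t _ => Real.exp (-s) ^ t) ≤ Real.exp (-s) := by
  conv_rhs => rw [← durMean_const (net := net) n a c (Real.exp (-s))]
  refine durMean_mono fun t j h => ?_
  refine pow_le_of_le_one (Real.exp_pos _).le (exp_neg_lt_one hs).le ?_
  rintro rfl
  exact h (durProb_zero net n a c j)

end Coefficients

/-! ### Reward, resource use and flow balance of the occupation measure. -/

section Identities

variable {N K L : ℕ} [NeZero L] {net : Network N K L}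

lemma stageReward_eq (s : ℝ) (ε : ℕ) (ω : Traj net) (n : Fin N) :
    stageReward s ε ω n = decTerm s ω n fun x _ t _ =>
      ∑ k ∈ Finset.range (t + ε), Real.exp (-s) ^ k * reward (net.user n) x k := rfl

lemma totalReward_eq (s : ℝ) (ε : ℕ) :
    totalReward s ε = fun ω : Traj net => ∑ n, ∑' m, decTerm s ω n (fun x _ t _ =>
      ∑ k ∈ Finset.range (t + ε), Real.exp (-s) ^ k * reward (net.user n) x k) m := by
  funext ω
  simp_rw [totalReward, stageReward_eq]

lemma integrable_totalReward {s : ℝ} (hs : 0 < s) (ε : ℕ) (u : Policy net) :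
    Integrable (totalReward s ε) (law net u) := by
  rw [totalReward_eq]
  exact integrable_finsetSum _ fun n _ => (integral_tsum_decTerm hs u n _).1

/-- The objective in terms of the occupation measure. -/
lemma value_eq {s : ℝ} (hs : 0 < s) (ε : ℕ) (u : Policy net) :
    value s ε u = lpObjective net s ε (occupation s u) := by
  rw [value, totalReward_eq, integral_finsetSum _ fun n _ => (integral_tsum_decTerm hs u n _).1,
    lpObjective]
  refine Finset.sum_congr rfl fun n _ => ?_
  rw [(integral_tsum_decTerm hs u n _).2]
  refine Finset.sum_congr rfl fun x _ => Finset.sum_congr rfl fun a _ => ?_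
  rw [rbar_eq, mul_comm]

/-- The discounted number of slots for which the downloads of a user are charged, summed over slots
or over decisions. -/
lemma tsum_ncard_eq {s : ℝ} (hs : 0 < s) (ε : ℕ) (ω : Traj net) (n : Fin N) :
    (Summable fun k => Real.exp (-s) ^ k * (Set.ncard {m : ℕ | decAction ω n m ≠ 0 ∧
      decSlot ω n m ≤ k ∧ k < decSlot ω n m + decDur ω n m + ε} : ℝ)) ∧
    ∑' k, Real.exp (-s) ^ k * (Set.ncard {m : ℕ | decAction ω n m ≠ 0 ∧
      decSlot ω n m ≤ k ∧ k < decSlot ω n m + decDur ω n m + ε} : ℝ) =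
    ∑' m, decTerm s ω n (fun _ a t _ => if a ≠ 0 then
      ∑ k ∈ Finset.range (t + ε), Real.exp (-s) ^ k else 0) m := by
  simp_rw [add_assoc (decSlot ω n _)]
  exact tsum_pow_mul_ncard (Real.exp_pos _).le (decSlot_strictMono ω n).id_le
    (fun m => decDur ω n m + ε) (fun m => decAction ω n m ≠ 0)
    (summable_decTerm hs ω n fun _ a t _ => if a ≠ 0 then
      ∑ k ∈ Finset.range (t + ε), Real.exp (-s) ^ k else 0)

lemma occupied_term_eq (s : ℝ) (ε : ℕ) (ω : Traj net) (k : ℕ) :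
    Real.exp (-s) ^ k * (occupied ε ω k : ℝ) = ∑ n, Real.exp (-s) ^ k *
      (Set.ncard {m : ℕ | decAction ω n m ≠ 0 ∧
        decSlot ω n m ≤ k ∧ k < decSlot ω n m + decDur ω n m + ε} : ℝ) := by
  rw [occupied, Nat.cast_sum, Finset.mul_sum]

lemma summable_occupied {s : ℝ} (hs : 0 < s) (ε : ℕ) (ω : Traj net) :
    Summable fun k => Real.exp (-s) ^ k * (occupied ε ω k : ℝ) := by
  simp_rw [occupied_term_eq]
  exact summable_sum fun n _ => (tsum_ncard_eq hs ε ω n).1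

lemma totalOccupied_eq {s : ℝ} (hs : 0 < s) (ε : ℕ) :
    totalOccupied s ε = fun ω : Traj net => ∑ n, ∑' m, decTerm s ω n (fun _ a t _ =>
      if a ≠ 0 then ∑ k ∈ Finset.range (t + ε), Real.exp (-s) ^ k else 0) m := by
  funext ω
  simp_rw [totalOccupied, occupied_term_eq]
  rw [Summable.tsum_finsetSum fun n _ => (tsum_ncard_eq hs ε ω n).1]
  exact Finset.sum_congr rfl fun n _ => (tsum_ncard_eq hs ε ω n).2

lemma integrable_totalOccupied {s : ℝ} (hs : 0 < s) (ε : ℕ) (u : Policy net) :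
    Integrable (totalOccupied s ε) (law net u) := by
  rw [totalOccupied_eq hs]
  exact integrable_finsetSum _ fun n _ => (integral_tsum_decTerm hs u n _).1

/-- The resource consumption in terms of the occupation measure. -/
lemma usage_eq {s : ℝ} (hs : 0 < s) (ε : ℕ) (u : Policy net) :
    usage s ε u = lpUsage net s ε (occupation s u) := by
  rw [usage, totalOccupied_eq hs,
    integral_finsetSum _ fun n _ => (integral_tsum_decTerm hs u n _).1, lpUsage]
  refine Finset.sum_congr rfl fun n _ => ?_
  rw [(integral_tsum_decTerm hs u n _).2, Finset.sum_comm (s := (Finset.univ : Finset (Fin L)))]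
  refine Finset.sum_congr rfl fun x _ => ?_
  rw [Fin.sum_univ_succ]
  simp [taubar_eq, durMean_const]

/-- The flow balance of the occupation measure. -/
lemma occupation_mem_polytope {s : ℝ} (hs : 0 < s) (u : Policy net) (n : Fin N) :
    occupation s u n ∈ polytope net s n := by
  refine ⟨occupation_nonneg s u n, fun j => ?_⟩
  -- `g₁` counts decisions made in `j`; `g₂` counts actions that end in `j`, discounted to their
  -- end.
  let g₁ : (net.user n).S → Action L → ℕ → Fin K → ℝ := fun x _ _ _ => if x = j then 1 else 0
  let g₂ : (net.user n).S → Action L → ℕ → Fin K → ℝ := fun x a t c =>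
    if (c, nextPlay (net.user n) a t x.2) = j then Real.exp (-s) ^ t else 0
  let F : Traj net → ℝ := fun ω => if (show ∀ n, (net.user n).S from ω 0) n = j then 1 else 0
  have hF : KnownAt 0 F := knownAt_of_le fun ω ω' h => by simp only [F, h 0 le_rfl]
  -- Shift of the decision index: a decision in `j` is either the initial one or made where the
  -- preceding action ended.
  have hpt : ∀ ω : Traj net, ∑' m, decTerm s ω n g₁ m = F ω + ∑' m, decTerm s ω n g₂ m :=
    fun ω => by
      rw [(summable_decTerm hs ω n g₁).tsum_eq_zero_add]
      congr 1
      · rw [decTerm, decSlot_zero, pow_zero, one_mul]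
        rfl
      · refine tsum_congr fun m => ?_
        simp only [decTerm, g₁, g₂, decState_succ, decSlot_succ, pow_add]
        split_ifs <;> ring
  have h₁ := (integral_tsum_decTerm hs u n g₁).2
  have h₂ := integral_tsum_decTerm hs u n g₂
  simp_rw [hpt] at h₁
  rw [integral_add (hF.integrable u) h₂.1, h₂.2] at h₁
  have hinit : ∫ ω, F ω ∂law net u = ((net.user n).init j).toReal :=
    (integral_initial u n fun x => if x = j then 1 else 0).trans (integral_ite_eq _ j)
  rw [hinit] at h₁
  have h₃ : ∑ x, ∑ a, occupation s u n x a * durMean net n a x.1 (g₁ x a) =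
      ∑ a, occupation s u n j a := by
    simp only [g₁, durMean_const]
    rw [Finset.sum_eq_single j]
    · simp
    · intro x _ hx
      simp [hx]
    · simp
  rw [← h₃, ← h₁]
  congr 1
  refine Finset.sum_congr rfl fun x _ => Finset.sum_congr rfl fun a _ => ?_
  rw [matH_eq, mul_comm]

lemma wellPosed {s : ℝ} (hs : 0 < s) (ε : ℕ) : WellPosed net s ε := by
  refine ⟨fun ω n => ?_, summable_occupied hs ε, fun ω n x a => ?_, fun u =>
    ⟨integrable_totalReward hs ε u, integrable_totalOccupied hs ε u, integrable_visits hs u⟩⟩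
  · rw [stageReward_eq]
    exact summable_decTerm hs ω n _
  · refine Summable.of_nonneg_of_le (fun k => mul_nonneg (pow_nonneg (Real.exp_pos _).le _)
      (indicator_nonneg ..)) (fun k => ?_)
      (summable_geometric_of_lt_one (Real.exp_pos _).le (exp_neg_lt_one hs))
    exact mul_le_of_le_one_right (pow_nonneg (Real.exp_pos _).le _) (indicator_le_one ..)

end Identities

/-! ### Stationary policies with prescribed action laws. -/

section Markov

variable {N K L : ℕ} [NeZero L] {net : Network N K L}

lemma sum_toReal_eq_one {α : Type*} [Fintype α] (p : PMF α) : ∑ a, (p a).toReal = 1 := by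
  rw [← ENNReal.toReal_sum fun a _ => p.apply_ne_top a, ← tsum_fintype (L := .unconditional α),
    p.tsum_coe, ENNReal.toReal_one]

/-- Under a Markov policy the occupation measure disintegrates along the action laws. -/
lemma occupation_eq_mul_sum {s : ℝ} (hs : 0 < s) {u : Policy net}
    {φ : ∀ n, (net.user n).S → PMF (Action L)}
    (hu : ∀ (k : ℕ) (ω : Traj net) (n : Fin N) (m : ℕ), decSlot ω n m = k →
      (u k (Preorder.frestrictLe k ω)).map (fun a => a n) = φ n (decState ω n m))
    (n : Fin N) (x : (net.user n).S) (a : Action L) :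
    occupation s u n x a = (φ n x a).toReal * ∑ b, occupation s u n x b := by
  classical
  -- The second factor, the expected discounted number of decisions in `x`, does not depend on `b`;
  -- summing over `b` identifies it.
  have h : ∀ b, occupation s u n x b = (φ n x b).toReal *
      ∑' k, Real.exp (-s) ^ k * ∫ ω, (if DecidesIn ω n x k then 1 else 0) ∂law net u := fun b => by
    rw [occupation_eq_tsum hs, ← tsum_mul_left]
    refine tsum_congr fun k => ?_
    rw [mul_left_comm]
    congr 1
    rw [← integral_const_mul]
    have hF : ∀ ω ω' : Traj net, (∀ i ≤ k, ω i = ω' i) →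
        (if DecidesIn ω n x k then (1 : ℝ) else 0) = if DecidesIn ω' n x k then 1 else 0 :=
      fun ω ω' h => if_congr (decidesIn_congr h n x) rfl rfl
    refine Eq.trans ?_ ((integral_mul_actionAt u hF n b).trans ?_)
    · congr 1 with ω
      rw [indicator_eq]
    · congr 1 with ω
      by_cases hd : DecidesIn ω n x k
      · obtain ⟨m, hm, rfl⟩ := id hd
        rw [hu k ω n m hm, mul_comm]
      · simp [hd]
  simp_rw [h]
  rw [← Finset.sum_mul, sum_toReal_eq_one, one_mul]

open Classical in
/-- The law of the action of user `n` in slot `k` under the stationary policy `φ`. -/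
noncomputable def actionLaw (φ : ∀ n, (net.user n).S → PMF (Action L)) (k : ℕ) (h : History net k)
    (n : Fin N) : PMF (Action L) :=
  if H : ∃ x, ∃ ω : Traj net, Preorder.frestrictLe k ω = h ∧ DecidesIn ω n x k then
    φ n H.choose else PMF.pure 0

/-- The history determines the state in which a user decides, so the choice made in `actionLaw` is
forced. -/
lemma actionLaw_eq (φ : ∀ n, (net.user n).S → PMF (Action L)) {k : ℕ} {ω : Traj net} {n : Fin N}
    {x : (net.user n).S} (hx : DecidesIn ω n x k) :
    actionLaw φ k (Preorder.frestrictLe k ω) n = φ n x := by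
  have H : ∃ x, ∃ ω' : Traj net, Preorder.frestrictLe k ω' = Preorder.frestrictLe k ω ∧
      DecidesIn ω' n x k := ⟨x, ω, rfl, hx⟩
  rw [actionLaw, dif_pos H]
  obtain ⟨ω', hω', hd⟩ := H.choose_spec
  have h : ∀ i ≤ k, ω' i = ω i := fun i hi => congrFun hω' ⟨i, Finset.mem_Iic.2 hi⟩
  rw [((decidesIn_congr h n _).1 hd).unique hx]

/-- The policy in which the users draw their actions independently from `φ`. -/
noncomputable def markovPolicy (φ : ∀ n, (net.user n).S → PMF (Action L)) : Policy net :=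
  fun k h => (Measure.pi fun n => (actionLaw φ k h n).toMeasure).toPMF

lemma markovPolicy_map (φ : ∀ n, (net.user n).S → PMF (Action L)) (k : ℕ) (ω : Traj net)
    (n : Fin N) (m : ℕ) (hm : decSlot ω n m = k) :
    (markovPolicy φ k (Preorder.frestrictLe k ω)).map (fun a => a n) = φ n (decState ω n m) := by
  rw [← actionLaw_eq φ ⟨m, hm, rfl⟩]
  refine PMF.toMeasure_injective ?_
  rw [← PMF.toMeasure_map _ _ (measurable_pi_apply n), markovPolicy, Measure.toPMF_toMeasure]
  exact (measurePreserving_eval _ n).map_eq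

end Markov

/-- Normalization; in a state that is never visited any law will do. -/
lemma exists_actionLaw {L : ℕ} {y : Action L → ℝ} (hy : ∀ a, 0 ≤ y a) :
    ∃ p : PMF (Action L), ∀ a, y a = (p a).toReal * ∑ b, y b := by
  have hnn : 0 ≤ ∑ b, y b := Finset.sum_nonneg fun b _ => hy b
  rcases hnn.eq_or_lt with h0 | hpos
  · refine ⟨PMF.pure 0, fun a => ?_⟩
    rw [← h0, mul_zero]
    exact (Finset.sum_eq_zero_iff_of_nonneg fun b _ => hy b).1 h0.symm a (Finset.mem_univ a)
  · refine ⟨PMF.ofFintype (fun a => ENNReal.ofReal (y a / ∑ b, y b)) ?_, fun a => ?_⟩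
    · rw [← ENNReal.ofReal_sum_of_nonneg fun a _ => div_nonneg (hy a) hnn, ← Finset.sum_div,
        div_self hpos.ne', ENNReal.ofReal_one]
    · rw [PMF.ofFintype_apply, ENNReal.toReal_ofReal (div_nonneg (hy a) hnn),
        div_mul_cancel₀ _ hpos.ne']

/-! ### Realizing polytope points by policies; compactness and feasibility. -/

section Polytope

variable {N K L : ℕ} [NeZero L] {net : Network N K L}

/-- An element of the polytope is determined by its action laws. -/
lemma polytope_unique {s : ℝ} (hs : 0 < s) {n : Fin N} {φ : (net.user n).S → PMF (Action L)}
    {y y' : (net.user n).S → Action L → ℝ} (hy : y ∈ polytope net s n) (hy' : y' ∈ polytope net s n)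
    (h : ∀ x a, y x a = (φ x a).toReal * ∑ b, y x b)
    (h' : ∀ x a, y' x a = (φ x a).toReal * ∑ b, y' x b) : y = y' := by
  let d : (net.user n).S → ℝ := fun x => ∑ b, y x b - ∑ b, y' x b
  have hd : ∀ j, d j = ∑ i, ∑ a, matH net s n a i j * ((φ i a).toReal * d i) := fun j => by
    simp only [d, mul_sub, Finset.sum_sub_distrib]
    simp_rw [← h, ← h']
    rw [hy.2 j, hy'.2 j]
    ring
  -- The difference of the total visits is a fixed point of a linear map that contracts the `ℓ¹`
  -- norm by `exp (-s)`.
  have hle : ∑ j, |d j| ≤ Real.exp (-s) * ∑ i, |d i| := by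
    calc ∑ j, |d j| ≤ ∑ j, ∑ i, ∑ a, matH net s n a i j * ((φ i a).toReal * |d i|) := by
          refine Finset.sum_le_sum fun j _ => ?_
          rw [hd j]
          refine (Finset.abs_sum_le_sum_abs _ _).trans (Finset.sum_le_sum fun i _ => ?_)
          refine (Finset.abs_sum_le_sum_abs _ _).trans (Finset.sum_le_sum fun a _ => ?_)
          rw [abs_mul, abs_mul, abs_of_nonneg (matH_nonneg net s n a i j),
            abs_of_nonneg ENNReal.toReal_nonneg]
      _ = ∑ i, ∑ a, (∑ j, matH net s n a i j) * ((φ i a).toReal * |d i|) := by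
          rw [Finset.sum_comm]
          refine Finset.sum_congr rfl fun i _ => ?_
          rw [Finset.sum_comm]
          simp_rw [Finset.sum_mul]
      _ ≤ ∑ i, ∑ a, Real.exp (-s) * ((φ i a).toReal * |d i|) := by
          refine Finset.sum_le_sum fun i _ => Finset.sum_le_sum fun a _ => ?_
          rw [sum_matH]
          exact mul_le_mul_of_nonneg_right (durMean_pow_le net hs n a i.1)
            (mul_nonneg ENNReal.toReal_nonneg (abs_nonneg _))
      _ = Real.exp (-s) * ∑ i, |d i| := by
          simp_rw [← Finset.mul_sum, ← Finset.sum_mul, sum_toReal_eq_one, one_mul]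
  have hnn : 0 ≤ ∑ j, |d j| := Finset.sum_nonneg fun j _ => abs_nonneg _
  have h0 : ∑ j, |d j| = 0 := by
    have := exp_neg_lt_one hs
    nlinarith
  have hd0 : ∀ x, ∑ b, y x b = ∑ b, y' x b := fun x => by
    have := (Finset.sum_eq_zero_iff_of_nonneg fun j _ => abs_nonneg (d j)).1 h0 x (Finset.mem_univ x)
    exact sub_eq_zero.1 (abs_eq_zero.1 this)
  funext x a
  rw [h, h', hd0]

/-- Every element of the product of the polytopes is the occupation measure of a Markov policy. -/
lemma exists_isMarkov_occupation_eq {s : ℝ} (hs : 0 < s) {y : Var net}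
    (hy : ∀ n, y n ∈ polytope net s n) : ∃ u : Policy net, IsMarkov u ∧ occupation s u = y := by
  choose φ hφ using fun n x => exists_actionLaw ((hy n).1 x)
  refine ⟨markovPolicy φ, ⟨φ, markovPolicy_map φ⟩, funext fun n => ?_⟩
  exact polytope_unique hs (occupation_mem_polytope hs _ n) (hy n)
    (occupation_eq_mul_sum hs (markovPolicy_map φ) n) (hφ n)

/-- The balance equations summed over all states. Every weight is at least `1 - exp (-s)`, so this
identity bounds the polytope. -/
lemma sum_polytope {s : ℝ} {n : Fin N} {y : (net.user n).S → Action L → ℝ}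
    (hy : y ∈ polytope net s n) :
    ∑ x, ∑ a, y x a * (1 - durMean net n a x.1 fun t _ => Real.exp (-s) ^ t) = 1 := by
  have h : ∑ j, ∑ a, y j a = ∑ j, ((net.user n).init j).toReal +
      ∑ i, ∑ a, y i a * durMean net n a i.1 fun t _ => Real.exp (-s) ^ t := by
    rw [Finset.sum_congr rfl fun j _ => hy.2 j, Finset.sum_add_distrib, Finset.sum_comm]
    congr 1
    refine Finset.sum_congr rfl fun i _ => ?_
    rw [Finset.sum_comm]
    refine Finset.sum_congr rfl fun a _ => ?_
    rw [← Finset.sum_mul, sum_matH, mul_comm]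
  rw [sum_toReal_eq_one] at h
  simp only [mul_sub, mul_one, Finset.sum_sub_distrib]
  linarith

lemma polytope_le {s : ℝ} (hs : 0 < s) {n : Fin N} {y : (net.user n).S → Action L → ℝ}
    (hy : y ∈ polytope net s n) (x : (net.user n).S) (a : Action L) :
    y x a ≤ (1 - Real.exp (-s))⁻¹ := by
  have hβ := sub_pos.2 (exp_neg_lt_one hs)
  have hle : ∀ x a, y x a * (1 - Real.exp (-s)) ≤
      y x a * (1 - durMean net n a x.1 fun t _ => Real.exp (-s) ^ t) := fun x a =>
    mul_le_mul_of_nonneg_left (by linarith [durMean_pow_le net hs n a x.1]) (hy.1 x a)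
  have hnn : ∀ x a, 0 ≤ y x a * (1 - durMean net n a x.1 fun t _ => Real.exp (-s) ^ t) :=
    fun x a => (mul_nonneg (hy.1 x a) hβ.le).trans (hle x a)
  rw [← one_div, le_div_iff₀ hβ]
  refine le_of_le_of_eq ((hle x a).trans ?_) (sum_polytope hy)
  refine (Finset.single_le_sum (f := fun a => y x a *
    (1 - durMean net n a x.1 fun t _ => Real.exp (-s) ^ t)) (fun a _ => hnn x a)
    (Finset.mem_univ a)).trans ?_
  exact Finset.single_le_sum (f := fun x => ∑ a, y x a *
    (1 - durMean net n a x.1 fun t _ => Real.exp (-s) ^ t))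
    (fun x _ => Finset.sum_nonneg fun a _ => hnn x a) (Finset.mem_univ x)

/-- A user that never waits occupies at least one subchannel in every slot. -/
lemma one_div_le_sum_taubar {s : ℝ} (hs : 0 < s) (ε : ℕ) {n : Fin N}
    {y : (net.user n).S → Action L → ℝ} (hy : y ∈ polytope net s n) (h0 : ∀ x, y x 0 = 0) :
    1 / (1 - Real.exp (-s)) ≤ ∑ l : Fin L, ∑ x, y x l.succ * taubar net s ε n x l.succ := by
  have hβ := sub_pos.2 (exp_neg_lt_one hs)
  rw [div_le_iff₀ hβ, Finset.sum_comm, Finset.sum_mul]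
  refine (sum_polytope hy).symm.trans_le ?_
  refine Finset.sum_le_sum fun x _ => ?_
  rw [Fin.sum_univ_succ, h0, zero_mul, zero_add, Finset.sum_mul]
  refine Finset.sum_le_sum fun l _ => ?_
  rw [mul_assoc]
  refine mul_le_mul_of_nonneg_left ?_ (hy.1 x _)
  rw [mul_comm]
  exact one_sub_durMean_pow_le net (exp_neg_lt_one hs).le ε n _ x

/-- The policy that always assigns the action `b` produces only visits with that action. -/
lemma exists_polytope_const {s : ℝ} (hs : 0 < s) (net : Network N K L) (b : Action L) :
    ∃ y : Var net, (∀ n, y n ∈ polytope net s n) ∧ ∀ n x a, a ≠ b → y n x a = 0 := by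
  let u : Policy net := fun _ _ => PMF.pure fun _ => b
  refine ⟨occupation s u, occupation_mem_polytope hs u, fun n x a hab => ?_⟩
  rw [occupation_eq_mul_sum hs (φ := fun _ _ => PMF.pure b) fun _ _ _ _ _ => PMF.pure_map ..,
    PMF.pure_apply, if_neg hab, ENNReal.toReal_zero, zero_mul]

lemma polytope_convex (net : Network N K L) (s : ℝ) (n : Fin N) : Convex ℝ (polytope net s n) := by
  intro y hy z hz p q hp hq hpq
  refine ⟨fun x a => add_nonneg (mul_nonneg hp (hy.1 x a)) (mul_nonneg hq (hz.1 x a)), fun j => ?_⟩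
  simp only [Pi.add_apply, Pi.smul_apply, smul_eq_mul, mul_add, Finset.sum_add_distrib,
    ← Finset.mul_sum, hy.2 j, hz.2 j, mul_left_comm _ p, mul_left_comm _ q]
  linear_combination ((net.user n).init j).toReal * hpq

/-- Resource use is linear, it is zero for the always passive policy and at least the required
amount for the one that always downloads; a convex combination meets the constraint exactly. -/
lemma lpFeasible_nonempty {s : ℝ} (hs : 0 < s) (net : Network N K L) (ε : ℕ) {M : ℕ}
    (hM : M ≤ N) : (lpFeasible net s ε M).Nonempty := by
  have hβ := sub_pos.2 (exp_neg_lt_one hs)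
  obtain ⟨y, hy, hy0⟩ := exists_polytope_const hs net 0
  obtain ⟨z, hz, hz0⟩ := exists_polytope_const hs net (Fin.succ 0)
  have hyu : lpUsage net s ε y = 0 :=
    Finset.sum_eq_zero fun n _ => Finset.sum_eq_zero fun l _ => Finset.sum_eq_zero fun x _ => by
      rw [hy0 n x _ l.succ_ne_zero, zero_mul]
  have hzu : M / (1 - Real.exp (-s)) ≤ lpUsage net s ε z := by
    calc (M : ℝ) / (1 - Real.exp (-s)) ≤ N / (1 - Real.exp (-s)) := by gcongr
      _ = ∑ _n : Fin N, 1 / (1 - Real.exp (-s)) := by simp [div_eq_mul_inv]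
      _ ≤ _ := Finset.sum_le_sum fun n _ => one_div_le_sum_taubar hs ε (hz n) fun x =>
          hz0 n x 0 (Fin.succ_ne_zero 0).symm
  have hM0 : 0 ≤ M / (1 - Real.exp (-s)) := div_nonneg (Nat.cast_nonneg M) hβ.le
  -- The weight of the downloading policy. If its usage is zero, the required amount is zero too,
  -- and the convention for division by zero is harmless.
  let q : ℝ := M / (1 - Real.exp (-s)) / lpUsage net s ε z
  have hq : q * lpUsage net s ε z = M / (1 - Real.exp (-s)) := by
    rcases eq_or_ne (lpUsage net s ε z) 0 with h0 | h0
    · rw [h0] at hzu ⊢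
      rw [mul_zero]
      exact hM0.antisymm hzu
    · exact div_mul_cancel₀ _ h0
  refine ⟨(1 - q) • y + q • z, fun n => ?_, ?_⟩
  · exact polytope_convex net s n (hy n) (hz n)
      (sub_nonneg.2 (div_le_one_of_le₀ hzu (hM0.trans hzu))) (div_nonneg hM0 (hM0.trans hzu))
      (sub_add_cancel 1 q)
  · have hlin : lpUsage net s ε ((1 - q) • y + q • z) =
        (1 - q) * lpUsage net s ε y + q * lpUsage net s ε z := by
      simp only [lpUsage, Pi.add_apply, Pi.smul_apply, smul_eq_mul, add_mul, mul_assoc,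
        Finset.sum_add_distrib, ← Finset.mul_sum]
    rw [hlin, hyu, hq, mul_zero, zero_add]

lemma lpFeasible_isCompact {s : ℝ} (hs : 0 < s) (net : Network N K L) (ε M : ℕ) :
    IsCompact (lpFeasible net s ε M) := by
  refine (isCompact_Icc (a := (0 : Var net))
    (b := fun _ _ _ => (1 - Real.exp (-s))⁻¹)).of_isClosed_subset ?_ fun y hy =>
      ⟨fun n x a => (hy.1 n).1 x a, fun n x a => polytope_le hs (hy.1 n) x a⟩
  have hpoly : ∀ n, IsClosed (polytope net s n) := fun n => by
    refine IsClosed.inter (s₁ := {y : (net.user n).S → Action L → ℝ | ∀ x a, 0 ≤ y x a})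
      (s₂ := {y : (net.user n).S → Action L → ℝ | ∀ j, ∑ a, y j a =
        ((net.user n).init j).toReal + ∑ i, ∑ a, matH net s n a i j * y i a}) ?_ ?_
    · simp only [Set.ofPred_forall]
      exact isClosed_iInter fun x => isClosed_iInter fun a =>
        isClosed_le continuous_const (by fun_prop)
    · simp only [Set.ofPred_forall]
      exact isClosed_iInter fun j => isClosed_eq (by fun_prop) (by fun_prop)
  refine IsClosed.inter (s₁ := {y : Var net | ∀ n, y n ∈ polytope net s n}) ?_ ?_
  · simp only [Set.ofPred_forall]
    exact isClosed_iInter fun n => (hpoly n).preimage (continuous_apply n)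
  · refine isClosed_eq ?_ continuous_const
    unfold lpUsage
    fun_prop

lemma continuous_lpObjective (net : Network N K L) (s : ℝ) (ε : ℕ) :
    Continuous (lpObjective net s ε) := by
  unfold lpObjective
  fun_prop

end Polytope

end MUSMDP

open MUSMDP in
theorem theorem2 {N K L : ℕ} [NeZero L] (net : Network N K L) (M : ℕ) (hM : M ≤ N)
    (s : ℝ) (hs : 0 < s) (ε : ℕ) (hε : ε = 0 ∨ ε = 1) :
    WellPosed net s ε ∧
    (∀ u : Policy net,
      (∀ n, occupation s u n ∈ polytope net s n) ∧
      value s ε u = lpObjective net s ε (occupation s u) ∧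
      usage s ε u = lpUsage net s ε (occupation s u)) ∧
    occupation s '' (Admissible s ε M : Set (Policy net)) = lpFeasible net s ε M ∧
    occupation s '' {u : Policy net | u ∈ Admissible s ε M ∧ IsMarkov u} =
      lpFeasible net s ε M ∧
    ∃ v : ℝ,
      IsGreatest (value s ε '' (Admissible s ε M : Set (Policy net))) v ∧
      IsGreatest (lpObjective net s ε '' lpFeasible net s ε M) v := by
  have hsub : occupation s '' (Admissible s ε M : Set (Policy net)) ⊆ lpFeasible net s ε M := by
    rintro _ ⟨u, hu, rfl⟩
    exact ⟨occupation_mem_polytope hs u, (usage_eq hs ε u).symm.trans hu⟩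
  have hsup : lpFeasible net s ε M ⊆
      occupation s '' {u : Policy net | u ∈ Admissible s ε M ∧ IsMarkov u} := by
    intro y hy
    obtain ⟨u, hu, rfl⟩ := exists_isMarkov_occupation_eq hs hy.1
    exact ⟨u, ⟨(usage_eq hs ε u).trans hy.2, hu⟩, rfl⟩
  have hmono : occupation s '' {u : Policy net | u ∈ Admissible s ε M ∧ IsMarkov u} ⊆
      occupation s '' (Admissible s ε M : Set (Policy net)) := Set.image_mono fun u hu => hu.1
  have hadm := hsub.antisymm (hsup.trans hmono)
  refine ⟨wellPosed hs ε, fun u => ⟨occupation_mem_polytope hs u, value_eq hs ε u,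
    usage_eq hs ε u⟩, hadm, (hmono.trans hsub).antisymm hsup, ?_⟩
  obtain ⟨v, hv⟩ := ((lpFeasible_isCompact hs net ε M).image
    (continuous_lpObjective net s ε)).exists_isGreatest ((lpFeasible_nonempty hs net ε hM).image _)
  -- The value of a policy factors through its occupation measure, so both problems have the same
  -- set of attained values.
  have himage : value s ε '' (Admissible s ε M : Set (Policy net)) =
      lpObjective net s ε '' lpFeasible net s ε M := by
    rw [← hadm, Set.image_image]
    exact Set.image_congr fun u _ => value_eq hs ε u
  exact ⟨v, himage ▸ hv, hv⟩
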